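/- Let $[K]=\{1,\dots,K\}$ and let a memoryless 1-to-$K$ broadcast packet erasure channel with channel output feedback be given by numbers $p_{S}\ge 0$ ($S\subseteq[K]$) with $\sum_{S\subseteq [K]}p_{S}=1$: in every time slot, independently of the other slots and of the transmitted symbols, the transmitted symbol (an element of a finite field $\mathbb F_q$) is received without error by exactly the receivers in $S$ with probability $p_{S}$ and is erased at all other receivers. For $S\subseteq[K]$ put $p_{\cup S}=\sum_{S':\,S'\cap S\neq\emptyset}p_{S'}$, and for disjoint $S,T\subseteq[K]$ put $f_p(S\overline{T})=\sum_{S_1:\,S\subseteq S_1,\;T\subseteq [K]\setminus S_1}p_{S_1}$. A code of length $n$ for rates $R_1,\dots,R_K\ge 0$ carries $\lceil nR_k\rceil$ information symbols $\mathbf X_k=(X_{k,j})_j$ for receiver $k$, for each $k\in[K]$; all information symbols are independent and uniform on $\mathbb F_q$. The symbol sent in slot $t$ is a function of all information symbols and of the channel outputs at all receivers in slots $1,\dots,t-1$, and receiver $k$ computes an estimate $\hat{\mathbf X}_k$ from its own $n$ channel outputs. The code is a linear network code if the symbol sent in slot $t$ is a linear combination over $\mathbb F_q$ of the information symbols, with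 coefficients that depend only on $t$ and on which receivers received the transmissions in slots $1,\dots,t-1$. The rate vector $(R_1,\dots,R_K)$ is achievable by a linear network code if for every $\epsilon>0$, for all sufficiently large $n$ and then all sufficiently large finite fields $\mathbb F_q$ (how large may depend on $n$), there is a linear network code with $\mathrm{Prob}(\hat{\mathbf X}_k\ne\mathbf X_k)<\epsilon$ for all $k\in[K]$. **Proposition.** Let $\prec$ be any strict total order on $2^{[K]}$ that is cardinality-compatible, i.e. $|S_1|<|S_2|$ implies $S_1\prec S_2$. The rate vector $(R_1,\dots,R_K)$, $R_k\ge0$, is achievable by a linear network code whenever there are numbers $x_S\ge0$ for all $S\subseteq[K]$ and $w_{k;S\to T}\ge0$ for all $k\in[K]$ and $T\subseteq S\subseteq[K]\setminus\{k\}$ that satisfy all of the following. 1. $\displaystyle\sum_{S\subseteq[K]}x_S<1$. 2. For all $T\subseteq[K]$ and $k\in T$: $\displaystyle x_T\ge\sum_{S:\;T\setminus\{k\}\subseteq S\subseteq[K]\setminus\{k\}}w_{k;S\to T\setminus\{k\}}$. 3. For all $k\in[K]$: $\displaystyle w_{k;\emptyset\to\emptyset}\,p_{\cup[K]}\ge R_k$.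 4. For all $k\in[K]$ and $\emptyset\ne S\subseteq[K]\setminus\{k\}$: $$\Big(\sum_{T_1\subseteq S}w_{k;S\to T_1}\Big)p_{\cup([K]\setminus S)}\ \ge\sum_{\substack{(S_1,T_1):\;T_1\subseteq S_1\subseteq[K]\setminus\{k\},\\ T_1\subseteq S,\;S\not\subseteq S_1}}w_{k;S_1\to T_1}\,f_p\big((S\setminus T_1)\overline{([K]\setminus S)}\big).$$ 5. For all $k\in[K]$ and $T\subsetneq S\subseteq[K]\setminus\{k\}$: $$\Big(w_{k;S\to T}+\sum_{\substack{T_1\subseteq S:\\ T_1\cup\{k\}\prec T\cup\{k\}}}w_{k;S\to T_1}\Big)p_{\cup([K]\setminus S)}\ \le\sum_{\substack{S_1:\;S_1\prec S,\\ T\subseteq S_1\subseteq[K]\setminus\{k\}}}w_{k;S_1\to T}\,f_p\big((S\setminus T)\overline{([K]\setminus S)}\big)+\sum_{\substack{(S_1,T_1):\;T_1\subseteq S_1\subseteq[K]\setminus\{k\},\\ T_1\cup\{k\}\prec T\cup\{k\},\\ T_1\subseteq S,\;S\not\subseteq S_1}}w_{k;S_1\to T_1}\,f_p\big((S\setminus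 T_1)\overline{([K]\setminus S)}\big).$$ -/

import Mathlib

open Finset

noncomputable section

/-- A memoryless 1-to-`K` broadcast packet erasure channel: `p S` is the probability that a
transmitted symbol is received by exactly the receivers in `S`. -/
structure BroadcastPEC (K : ℕ) where
  p : Finset (Fin K) → ℝ
  p_nonneg : ∀ S, 0 ≤ p S
  p_sum : ∑ S, p S = 1

/-- `p_{∪S}`: the probability that at least one receiver in `S` receives the symbol. -/
def BroadcastPEC.pUnion {K : ℕ} (P : BroadcastPEC K) (S : Finset (Fin K)) : ℝ :=
  ∑ S' with (S' ∩ S).Nonempty, P.p S'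

/-- `f_p(S T̄)`: the probability that all receivers in `S` and no receiver in `T` receive the
symbol. -/
def BroadcastPEC.fp {K : ℕ} (P : BroadcastPEC K) (S T : Finset (Fin K)) : ℝ :=
  ∑ S₁ with S ⊆ S₁ ∧ T ⊆ univ \ S₁, P.p S₁

/-- The information symbols: `L k` symbols of `F` for session `k`. -/
abbrev Messages {K : ℕ} (L : Fin K → ℕ) (F : Type) : Type :=
  (k : Fin K) → Fin (L k) → F

/-- A code with channel output feedback that uses the channel `n` times and carries `L k` symbols
of `F` for receiver `k`. A channel output is an element of `Option F`, with `none` the erasure.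
`enc t` produces the symbol sent in slot `t` from the information symbols and from the outputs at
all receivers in the earlier slots; `dec k` is the decoder of receiver `k`, which sees only its own
outputs. -/
structure FeedbackCode {K : ℕ} (n : ℕ) (L : Fin K → ℕ) (F : Type) where
  enc : (t : Fin n) → Messages L F → (Fin t → Fin K → Option F) → F
  dec : (k : Fin K) → (Fin n → Option F) → (Fin (L k) → F)

namespace FeedbackCode

variable {K n : ℕ} {L : Fin K → ℕ} {F : Type}

/-- The output `Z_k(t)` at receiver `k` in slot `t` when the information symbols are `X` and
`s τ` is the set of receivers that are reached in slot `τ`. -/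
def output (c : FeedbackCode n L F) (X : Messages L F) (s : Fin n → Finset (Fin K)) (t : Fin n) :
    Fin K → Option F := fun k =>
  if k ∈ s t then
    some (c.enc t X (fun τ : Fin t => output c X s ⟨τ, τ.2.trans t.2⟩))
  else none
termination_by t.val
decreasing_by exact τ.2

/-- The decoded symbols of receiver `k`. -/
def decoded (c : FeedbackCode n L F) (X : Messages L F) (s : Fin n → Finset (Fin K))
    (k : Fin K) : Fin (L k) → F :=
  c.dec k (fun t => c.output X s t k)

open Classical in
/-- The probability that receiver `k` does not decode all its symbols correctly, when the
information symbols are independent and uniform on `F` and, independently of them, the sets of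
reached receivers in the `n` slots are independent with law `P.p`. -/
def errorProb [Fintype F] (c : FeedbackCode n L F) (P : BroadcastPEC K) (k : Fin K) : ℝ :=
  ∑ s : Fin n → Finset (Fin K), (∏ t, P.p (s t)) *
    ((#{X : Messages L F | c.decoded X s k ≠ X k} : ℝ) / Fintype.card (Messages L F))

/-- The code is a linear network code: each transmitted symbol is `v · X`, with `X` the vector of
all information symbols and `v` a coding vector over `F` that depends only on the slot and on which
receivers have been reached in the earlier slots. -/
def IsLinear [Field F] (c : FeedbackCode n L F) : Prop :=
  ∃ v : (t : Fin n) → (Fin t → Finset (Fin K)) → (k : Fin K) → Fin (L k) → F,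
    ∀ (t : Fin n) (X : Messages L F) (z : Fin t → Fin K → Option F),
      c.enc t X z =
        ∑ k, ∑ j, v t (fun τ => ({i | (z τ i).isSome} : Finset (Fin K))) k j * X k j

end FeedbackCode

/-- The rate vector `R` is achievable by linear network codes: for every `ε > 0`, for all
sufficiently large block lengths `n` and then all sufficiently large finite fields, some linear
network code carrying `n R_k` symbols (rounded up) for each session `k` has error probability below
`ε` at every receiver. -/
def LinearlyAchievable {K : ℕ} (P : BroadcastPEC K) (R : Fin K → ℝ) : Prop :=
  ∀ ε : ℝ, 0 < ε → ∃ N : ℕ, ∀ n : ℕ, N ≤ n → ∃ q₀ : ℕ,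
    ∀ (F : Type) [Field F] [Fintype F], q₀ ≤ Fintype.card F →
      ∃ c : FeedbackCode n (fun k => ⌈(n : ℝ) * R k⌉₊) F,
        c.IsLinear ∧ ∀ k, c.errorProb P k < ε

/-- A relation on subsets of `[K]` is cardinality-compatible if smaller sets come first. -/
def CardinalityCompatible {K : ℕ} (prec : Finset (Fin K) → Finset (Fin K) → Prop) : Prop :=
  ∀ S₁ S₂ : Finset (Fin K), #S₁ < #S₂ → prec S₁ S₂

open Classical in
/-- The linear program in the variables `x S` and `w k S T`; only the `w k S T` with
`T ⊆ S ⊆ [K] \ {k}` are variables of the program, the other values of `w` are never used. -/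
structure InnerBoundLP {K : ℕ} (P : BroadcastPEC K)
    (prec : Finset (Fin K) → Finset (Fin K) → Prop) (R : Fin K → ℝ)
    (x : Finset (Fin K) → ℝ) (w : Fin K → Finset (Fin K) → Finset (Fin K) → ℝ) : Prop where
  x_nonneg : ∀ S, 0 ≤ x S
  w_nonneg : ∀ k S T, T ⊆ S → S ⊆ univ \ {k} → 0 ≤ w k S T
  total : ∑ S, x S < 1
  coding_length : ∀ T : Finset (Fin K), ∀ k ∈ T,
    ∑ S with T \ {k} ⊆ S ∧ S ⊆ univ \ {k}, w k S (T \ {k}) ≤ x T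
  rate : ∀ k, R k ≤ w k ∅ ∅ * P.pUnion univ
  clean_up : ∀ (k : Fin K) (S : Finset (Fin K)), S ⊆ univ \ {k} → S ≠ ∅ →
    ∑ a : Finset (Fin K) × Finset (Fin K) with
        a.2 ⊆ a.1 ∧ a.1 ⊆ univ \ {k} ∧ a.2 ⊆ S ∧ ¬ S ⊆ a.1,
      w k a.1 a.2 * P.fp (S \ a.2) (univ \ S)
    ≤ (∑ T₁ with T₁ ⊆ S, w k S T₁) * P.pUnion (univ \ S)
  conservation : ∀ (k : Fin K) (S T : Finset (Fin K)), T ⊆ S → S ⊆ univ \ {k} → T ≠ S →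
    (w k S T + ∑ T₁ with T₁ ⊆ S ∧ prec (T₁ ∪ {k}) (T ∪ {k}), w k S T₁) * P.pUnion (univ \ S)
    ≤ (∑ S₁ with prec S₁ S ∧ T ⊆ S₁ ∧ S₁ ⊆ univ \ {k},
        w k S₁ T * P.fp (S \ T) (univ \ S))
      + ∑ a : Finset (Fin K) × Finset (Fin K) with
          a.2 ⊆ a.1 ∧ a.1 ⊆ univ \ {k} ∧ prec (a.2 ∪ {k}) (T ∪ {k}) ∧ a.2 ⊆ S ∧ ¬ S ⊆ a.1,
        w k a.1 a.2 * P.fp (S \ a.2) (univ \ S)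

end

/-!
The rates are achieved by *packet evolution*. Every information symbol of session `k` is a packet,
which carries a coding vector and a status. The status is a set of receivers that the packet does
not disturb, in that its coding vector lies in the span of what such a receiver knows and of its
own symbols. If at most one packet of each session `k ∈ T` is picked, with a status that contains
`T \ {k}`, then the coding vectors of these packets all lie in the space `W` of vectors that
disturb no receiver in `T`. A vector `x ∈ W` is sent. When the receivers in `A` are reached and
`A` is not contained in the status of a picked packet, that packet takes the coding vector `x` and
the status `(T \ {k}) ∪ A`; it is finished when `k ∈ A`. The invariant `CodingState.Inv` says
moreover that, for each session, the coding vectors of the unfinished packets make up for what the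
receiver lacks. It persists if `x` avoids at most one proper subspace of `W` for each picked
packet, which is possible over a field with at least `K` elements
(`Submodule.exists_mem_forall_notMem`). So receiver `k` can decode as soon as its packets are
finished (`single_mem_of_finished`), and this depends only on the reception sets.

A receiver does not see which other receivers have been reached, so it does not know the coding
vectors. Therefore the code ends with two blocks in which the sum of all symbols is sent first
plain and then multiplied by a field element that labels the reception history; the field is taken
large enough for that. A receiver reached in both blocks recovers the label unless the sum is zero
(`Decodable.messages_eq`, `exists_linear_code`).

The linear program gives the schedule. Phase `T` has length `n * x T`, the phases follow each
other in the order `≺`, and session `k` uses `n * w k S (T \ {k})` slots of the phase for packets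
of status `S`, again in the order `≺`. For one session and one status `S`, the packets form a
queue whose arrivals and departures, if no slot is idle, are sums of independent terms. A slot
that is idle because the queue is empty does no harm: dropping the packets that it would have
moved on can only shorten the other queues. Hence the final length of a queue is bounded by its
net input since the start or since some slot in which it was served (`queue_le_net_input`). The
constraints `clean_up` and `rate` make the initial supply plus the expected net input since the
start at most zero, and their combination with `conservation` does the same for the input after
any stage that serves `S` (`sum_drift_le`, `sum_drift_after_le`). By Chernoff's bound all queues
are then shorter than `δ * n`, up to a constant, with high probability. As the `x S` add up to
less than one, a linear number of slots is left over. There the remaining packets are sent to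
their receivers one by one, which works because a receiver with a positive rate is reached with
positive probability (`rate_le`).
-/

noncomputable section

/-! ### Packet evolution: schedules and the status of a packet -/

/-- A transmission schedule. In slot `t` the packets of the sessions in `mix t` are mixed, and
session `k` takes part with any of its packets whose status `S` satisfies `elig t k S`. Only
unfinished packets may take part, and only if their status contains all other mixed sessions. The
status of a packet is a set of receivers that the packet does not disturb; a packet of session `k`
is finished as soon as `k` lies in its status. -/
structure Schedule (K : ℕ) where
  mix : ℕ → Finset (Fin K)
  elig : ℕ → Fin K → Finset (Fin K) → Prop
  valid : ∀ t k S, elig t k S → k ∈ mix t ∧ mix t \ {k} ⊆ S ∧ k ∉ S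

namespace Schedule

variable {K : ℕ} (D : Schedule K)

open Classical in
/-- The packet with which session `k` takes part in slot `t`, if there is an eligible one. -/
def pick {m : ℕ} (t : ℕ) (k : Fin K) (σ : Fin m → Finset (Fin K)) : Option (Fin m) :=
  if h : ∃ j, D.elig t k (σ j) then some h.choose else none

lemma elig_of_pick {m : ℕ} {t : ℕ} {k : Fin K} {σ : Fin m → Finset (Fin K)} {j : Fin m}
    (h : D.pick t k σ = some j) : D.elig t k (σ j) := by
  unfold pick at h
  split_ifs at h with h'
  cases h
  exact h'.choose_spec

lemma exists_pick {m : ℕ} {t : ℕ} {k : Fin K} {σ : Fin m → Finset (Fin K)} {j : Fin m}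
    (h : D.elig t k (σ j)) : ∃ i, D.pick t k σ = some i := by
  unfold pick
  rw [dif_pos ⟨j, h⟩]
  exact ⟨_, rfl⟩

/-- The statuses of the `m` packets of session `k` before slot `t`, when `s τ` is the set of
receivers reached in slot `τ`. A picked packet changes its status only if its current status does
not already contain all the receivers that have been reached. -/
def status (m : ℕ) (s : ℕ → Finset (Fin K)) (k : Fin K) : ℕ → Fin m → Finset (Fin K)
  | 0 => fun _ => ∅
  | t + 1 => fun j =>
      if D.pick t k (status m s k t) = some j ∧ ¬ s t ⊆ status m s k t j
      then D.mix t \ {k} ∪ s t else status m s k t j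

lemma status_succ (m : ℕ) (s : ℕ → Finset (Fin K)) (k : Fin K) (t : ℕ) (j : Fin m) :
    D.status m s k (t + 1) j =
      if D.pick t k (D.status m s k t) = some j ∧ ¬ s t ⊆ D.status m s k t j
      then D.mix t \ {k} ∪ s t else D.status m s k t j := rfl

lemma status_congr (m : ℕ) {s s' : ℕ → Finset (Fin K)} (k : Fin K) {t : ℕ}
    (h : ∀ τ < t, s τ = s' τ) : D.status m s k t = D.status m s' k t := by
  induction t with
  | zero => rfl
  | succ t ih =>
    have ih' := ih fun τ hτ => h τ (hτ.trans (Nat.lt_succ_self t))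
    funext j
    rw [status_succ, status_succ, ih', h t (Nat.lt_succ_self t)]

end Schedule

/-! ### Packet evolution: coding vectors -/

/-- Over a field with at least as many elements as there are subspaces, a subspace that lies in none
of finitely many subspaces is not covered by their union. -/
lemma Submodule.exists_mem_forall_notMem {F V ι : Type*} [Field F] [Fintype F] [AddCommGroup V]
    [Module F V] (W : Submodule F V) (U : ι → Submodule F V) (I : Finset ι)
    (hI : #I ≤ Fintype.card F) (h : ∀ i ∈ I, ¬ W ≤ U i) : ∃ x ∈ W, ∀ i ∈ I, x ∉ U i := by
  classical
  induction I using Finset.induction_on with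
  | empty => exact ⟨0, W.zero_mem, by simp⟩
  | insert a I ha ih =>
    rw [card_insert_of_notMem ha] at hI
    obtain ⟨x, hxW, hx⟩ := ih (by omega) fun i hi => h i (mem_insert_of_mem hi)
    by_cases hxa : x ∈ U a
    · obtain ⟨y, hyW, hya⟩ := SetLike.not_le_iff_exists.1 (h a (mem_insert_self a I))
      -- Each subspace `U i` with `i ∈ I` contains at most one point of the line `y + c • x`.
      have key : ∃ c : F, ∀ i ∈ I, y + c • x ∉ U i := by
        by_contra! hcon
        choose f hfI hf using hcon
        have hlt : #I < #(univ : Finset F) := by rw [card_univ]; omega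
        obtain ⟨c, -, d, -, hcd, hfcd⟩ :=
          exists_ne_map_eq_of_card_lt_of_maps_to hlt (f := f) fun c _ => hfI c
        have h1 := (U (f c)).sub_mem (hf c) (hfcd ▸ hf d)
        rw [add_sub_add_left_eq_sub, ← sub_smul] at h1
        exact hx _ (hfI c) (((U (f c)).smul_mem_iff (sub_ne_zero.2 hcd)).1 h1)
      obtain ⟨c, hc⟩ := key
      refine ⟨y + c • x, W.add_mem hyW (W.smul_mem c hxW), fun i hi => ?_⟩
      rcases mem_insert.1 hi with rfl | hi
      · exact fun hmem => hya (((U i).add_mem_iff_left ((U i).smul_mem c hxa)).1 hmem)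
      · exact hc i hi
    · refine ⟨x, hxW, fun i hi => ?_⟩
      rcases mem_insert.1 hi with rfl | hi
      exacts [hxa, hx i hi]

section Coding

variable {K : ℕ} (L : Fin K → ℕ) (F : Type) [Field F]

/-- The space of coding vectors that involve only the information symbols of session `k`. -/
def messageSpace (k : Fin K) : Submodule F (Messages L F) :=
  Submodule.span F (Set.range fun j : Fin (L k) => Pi.single k (Pi.single j 1))

/-- A state of the evolving code: a coding vector for every packet, and for every receiver the span
of the coding vectors it has received. -/
structure CodingState where
  vec : (k : Fin K) → Fin (L k) → Messages L F
  known : Fin K → Submodule F (Messages L F)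

variable {L F}

namespace CodingState

/-- The span of what receiver `k` knows and of its unfinished packets other than those in `J`. -/
def reach (C : CodingState L F) (σ : (k : Fin K) → Fin (L k) → Finset (Fin K)) (k : Fin K)
    (J : Set (Fin (L k))) : Submodule F (Messages L F) :=
  C.known k ⊔ Submodule.span F (C.vec k '' {j | k ∉ σ k j ∧ j ∉ J})

/-- The invariant of packet evolution. A packet is harmless to its own receiver and to all receivers
in its status, in that it adds to their knowledge only combinations of their own symbols; and the
unfinished packets of a session are all that its receiver lacks. -/
structure Inv (C : CodingState L F) (σ : (k : Fin K) → Fin (L k) → Finset (Fin K)) : Prop where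
  harmless : ∀ k j, ∀ i ∈ insert k (σ k j), C.vec k j ∈ C.known i ⊔ messageSpace L F i
  complete : ∀ k, messageSpace L F k ≤ C.reach σ k ∅

/-- A coding vector suits slot `t` if it is harmless to the receivers of the mixed sessions and can
replace each of the picked packets. -/
def Suitable (D : Schedule K) (t : ℕ) (C : CodingState L F)
    (σ : (k : Fin K) → Fin (L k) → Finset (Fin K)) (x : Messages L F) : Prop :=
  (∀ i ∈ D.mix t, x ∈ C.known i ⊔ messageSpace L F i) ∧
    ∀ k j, D.pick t k (σ k) = some j → C.vec k j ∈ C.reach σ k {j} ⊔ Submodule.span F {x}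

lemma Inv.exists_suitable [Fintype F] {D : Schedule K} {t : ℕ} {C : CodingState L F}
    {σ : (k : Fin K) → Fin (L k) → Finset (Fin K)} (hC : C.Inv σ)
    (hq : K ≤ Fintype.card F) : ∃ x, C.Suitable D t σ x := by
  classical
  set W : Submodule F (Messages L F) := ⨅ i ∈ D.mix t, C.known i ⊔ messageSpace L F i with hW
  have hpick : ∀ k j, D.pick t k (σ k) = some j → C.vec k j ∈ W := by
    intro k j hj
    obtain ⟨-, hsub, -⟩ := D.valid _ _ _ (D.elig_of_pick hj)
    simp only [hW, Submodule.mem_iInf]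
    intro i hi
    refine hC.harmless k j i ?_
    by_cases hik : i = k
    · exact mem_insert.2 (Or.inl hik)
    · exact mem_insert_of_mem (hsub (by simp [hi, hik]))
  let U : Fin K → Submodule F (Messages L F) := fun k =>
    (D.pick t k (σ k)).elim ⊥ fun j => C.reach σ k {j}
  let I : Finset (Fin K) := {k | ¬ W ≤ U k}
  have hI : #I ≤ Fintype.card F := by
    refine (card_le_univ I).trans ?_
    simpa using hq
  obtain ⟨x, hxW, hx⟩ := W.exists_mem_forall_notMem U I hI (by simp [I])
  have hxW' : ∀ i ∈ D.mix t, x ∈ C.known i ⊔ messageSpace L F i := by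
    simpa only [hW, Submodule.mem_iInf] using hxW
  refine ⟨x, hxW', fun k j hj => ?_⟩
  have hUk : U k = C.reach σ k {j} := by simp [U, hj]
  obtain ⟨hkmix, -, hkσ⟩ := D.valid _ _ _ (D.elig_of_pick hj)
  by_cases hv : C.vec k j ∈ C.reach σ k {j}
  · exact Submodule.mem_sup_left hv
  have hxU : x ∉ C.reach σ k {j} := by
    rw [← hUk]
    refine hx k ?_
    simp only [I, mem_filter, mem_univ, true_and]
    exact fun hle => hv (hUk ▸ hle (hpick k j hj))
  -- The vector `x` lies in the span of `reach` and `vec k j`, with a nonzero last coefficient.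
  have hx' : x ∈ C.reach σ k {j} ⊔ Submodule.span F {C.vec k j} := by
    have h1 : C.known k ⊔ messageSpace L F k ≤ C.reach σ k {j} ⊔ Submodule.span F {C.vec k j} := by
      refine sup_le (le_sup_left.trans le_sup_left) ((hC.complete k).trans ?_)
      refine sup_le (le_sup_left.trans le_sup_left) (Submodule.span_le.2 ?_)
      rintro _ ⟨i, ⟨hi, -⟩, rfl⟩
      by_cases hij : i = j
      · subst hij
        exact Submodule.mem_sup_right (Submodule.mem_span_singleton_self _)
      · exact Submodule.mem_sup_left (Submodule.mem_sup_right
          (Submodule.subset_span ⟨i, ⟨hi, hij⟩, rfl⟩))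
    exact h1 (hxW' k hkmix)
  obtain ⟨u, hu, z, hz, huz⟩ := Submodule.mem_sup.1 hx'
  obtain ⟨c, rfl⟩ := Submodule.mem_span_singleton.1 hz
  have hc : c ≠ 0 := by
    rintro rfl
    exact hxU (by simpa [← huz] using hu)
  have hvec : C.vec k j = c⁻¹ • x - c⁻¹ • u := by
    rw [← huz, smul_add, smul_smul, inv_mul_cancel₀ hc, one_smul, add_sub_cancel_left]
  rw [hvec]
  exact Submodule.sub_mem _
    (Submodule.mem_sup_right (Submodule.smul_mem _ _ (Submodule.mem_span_singleton_self x)))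
    (Submodule.mem_sup_left (Submodule.smul_mem _ _ hu))

/-- The state after `x` has been sent in slot `t` and received by the receivers in `A`. -/
def next (D : Schedule K) (t : ℕ) (C : CodingState L F)
    (σ : (k : Fin K) → Fin (L k) → Finset (Fin K)) (x : Messages L F) (A : Finset (Fin K)) :
    CodingState L F where
  vec k j := if D.pick t k (σ k) = some j ∧ ¬ A ⊆ σ k j then x else C.vec k j
  known i := if i ∈ A then C.known i ⊔ Submodule.span F {x} else C.known i

lemma Inv.next {D : Schedule K} {t : ℕ} {C : CodingState L F}
    {σ : (k : Fin K) → Fin (L k) → Finset (Fin K)} (hC : C.Inv σ) {x : Messages L F}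
    (hx : C.Suitable D t σ x) (A : Finset (Fin K)) :
    (C.next D t σ x A).Inv fun k j =>
      if D.pick t k (σ k) = some j ∧ ¬ A ⊆ σ k j then D.mix t \ {k} ∪ A else σ k j := by
  have hmono : ∀ i, C.known i ≤ (C.next D t σ x A).known i := by
    intro i
    simp only [CodingState.next]
    split_ifs
    exacts [le_sup_left, le_rfl]
  constructor
  · intro k j i hi
    by_cases hup : D.pick t k (σ k) = some j ∧ ¬ A ⊆ σ k j
    · have hvec : (C.next D t σ x A).vec k j = x := if_pos hup
      rw [if_pos hup] at hi
      rw [hvec]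
      by_cases hiA : i ∈ A
      · refine Submodule.mem_sup_left ?_
        simp only [CodingState.next, if_pos hiA]
        exact Submodule.mem_sup_right (Submodule.mem_span_singleton_self x)
      · refine sup_le_sup_right (hmono i) _ (hx.1 i ?_)
        have hk := (D.valid _ _ _ (D.elig_of_pick hup.1)).1
        simp only [mem_insert, mem_union, mem_sdiff, hiA, or_false] at hi
        rcases hi with rfl | hi
        exacts [hk, hi.1]
    · have hvec : (C.next D t σ x A).vec k j = C.vec k j := if_neg hup
      rw [if_neg hup] at hi
      rw [hvec]
      exact sup_le_sup_right (hmono i) _ (hC.harmless k j i hi)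
  · intro k
    refine (hC.complete k).trans (sup_le ((hmono k).trans le_sup_left) (Submodule.span_le.2 ?_))
    rintro _ ⟨i, ⟨hi, -⟩, rfl⟩
    -- A packet that is not replaced stays in the span.
    have hkeep : ∀ i, k ∉ σ k i → ¬ (D.pick t k (σ k) = some i ∧ ¬ A ⊆ σ k i) →
        C.vec k i ∈ (C.next D t σ x A).reach (fun k j =>
          if D.pick t k (σ k) = some j ∧ ¬ A ⊆ σ k j then D.mix t \ {k} ∪ A else σ k j) k ∅ := by
      intro i hi hup
      refine Submodule.mem_sup_right (Submodule.subset_span ⟨i, ⟨?_, by simp⟩, if_neg hup⟩)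
      beta_reduce
      rwa [if_neg hup]
    by_cases hup : D.pick t k (σ k) = some i ∧ ¬ A ⊆ σ k i
    · refine (sup_le (sup_le ((hmono k).trans le_sup_left) (Submodule.span_le.2 ?_)) ?_ :
        C.reach σ k {i} ⊔ Submodule.span F {x} ≤ _) (hx.2 k i hup.1)
      · rintro _ ⟨l, ⟨hl, hli⟩, rfl⟩
        refine hkeep l hl fun h => hli ?_
        exact (Option.some.inj (hup.1.symm.trans h.1)).symm
      · rw [Submodule.span_singleton_le_iff_mem]
        by_cases hkA : k ∈ A
        · refine Submodule.mem_sup_left ?_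
          simp only [CodingState.next, if_pos hkA]
          exact Submodule.mem_sup_right (Submodule.mem_span_singleton_self x)
        · refine Submodule.mem_sup_right (Submodule.subset_span ⟨i, ⟨?_, by simp⟩, if_pos hup⟩)
          beta_reduce
          rw [if_pos hup]
          simp [hkA]
    · exact hkeep i hi hup

variable (L F)

open Classical in
/-- A suitable coding vector for slot `t`, if there is one. -/
def choose (D : Schedule K) (t : ℕ) (C : CodingState L F)
    (σ : (k : Fin K) → Fin (L k) → Finset (Fin K)) : Messages L F :=
  if h : ∃ x, C.Suitable D t σ x then h.choose else 0

/-- The state before slot `t` when `s τ` is the set of receivers reached in slot `τ`. The packets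
start as the information symbols themselves. -/
def evolve (D : Schedule K) (s : ℕ → Finset (Fin K)) : ℕ → CodingState L F
  | 0 => ⟨fun k j => Pi.single k (Pi.single j 1), fun _ => ⊥⟩
  | t + 1 => (evolve D s t).next D t (fun k => D.status (L k) s k t)
      (choose L F D t (evolve D s t) fun k => D.status (L k) s k t) (s t)

/-- The coding vector of slot `t`. -/
def sent (D : Schedule K) (s : ℕ → Finset (Fin K)) (t : ℕ) : Messages L F :=
  choose L F D t (evolve L F D s t) fun k => D.status (L k) s k t

lemma evolve_congr (D : Schedule K) {s s' : ℕ → Finset (Fin K)} {t : ℕ}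
    (h : ∀ τ < t, s τ = s' τ) : evolve L F D s t = evolve L F D s' t := by
  induction t with
  | zero => rfl
  | succ t ih =>
    have h' : ∀ τ < t, s τ = s' τ := fun τ hτ => h τ (hτ.trans (Nat.lt_succ_self t))
    have hσ : (fun k => D.status (L k) s k t) = fun k => D.status (L k) s' k t :=
      funext fun k => D.status_congr (L k) k h'
    rw [evolve, evolve, ih h', hσ, h t (Nat.lt_succ_self t)]

lemma sent_congr (D : Schedule K) {s s' : ℕ → Finset (Fin K)} {t : ℕ}
    (h : ∀ τ < t, s τ = s' τ) : sent L F D s t = sent L F D s' t := by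
  have hσ : (fun k => D.status (L k) s k t) = fun k => D.status (L k) s' k t :=
    funext fun k => D.status_congr (L k) k h
  rw [sent, sent, evolve_congr L F D h, hσ]

lemma inv_evolve [Fintype F] (D : Schedule K) (s : ℕ → Finset (Fin K))
    (hq : K ≤ Fintype.card F) (t : ℕ) :
    (evolve L F D s t).Inv fun k => D.status (L k) s k t := by
  induction t with
  | zero =>
    constructor
    · intro k j i hi
      obtain rfl : i = k := by simpa [Schedule.status] using hi
      exact Submodule.mem_sup_right (Submodule.subset_span ⟨j, rfl⟩)
    · intro k
      refine Submodule.span_le.2 ?_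
      rintro _ ⟨j, rfl⟩
      exact Submodule.mem_sup_right (Submodule.subset_span ⟨j, by simp [Schedule.status], rfl⟩)
  | succ t ih =>
    have hx : ∃ x, (evolve L F D s t).Suitable D t (fun k => D.status (L k) s k t) x :=
      ih.exists_suitable hq
    refine ih.next (x := sent L F D s t) ?_ (s t)
    rw [sent, choose, dif_pos hx]
    exact hx.choose_spec

/-- What a receiver knows is spanned by the coding vectors sent while it was reached. -/
lemma known_evolve_le (D : Schedule K) (s : ℕ → Finset (Fin K)) (i : Fin K) (t : ℕ)
    (Y : Submodule F (Messages L F)) (h : ∀ τ < t, i ∈ s τ → sent L F D s τ ∈ Y) :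
    (evolve L F D s t).known i ≤ Y := by
  induction t with
  | zero => exact bot_le
  | succ t ih =>
    have ih' := ih fun τ hτ => h τ (hτ.trans (Nat.lt_succ_self t))
    change (if i ∈ s t then _ else _) ≤ Y
    split_ifs with hi
    · exact sup_le ih' ((Submodule.span_singleton_le_iff_mem _ _).2 (h t (Nat.lt_succ_self t) hi))
    · exact ih'

end CodingState

/-- If all packets of session `k` are finished before slot `t`, then the coding vectors that
receiver `k` has received span the symbols of session `k`. -/
theorem single_mem_of_finished [Fintype F] (D : Schedule K) (s : ℕ → Finset (Fin K))
    (hq : K ≤ Fintype.card F) {t : ℕ} {k : Fin K} (hfin : ∀ j, k ∈ D.status (L k) s k t j)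
    (Y : Submodule F (Messages L F))
    (h : ∀ τ < t, k ∈ s τ → CodingState.sent L F D s τ ∈ Y) (j : Fin (L k)) :
    Pi.single k (Pi.single j 1) ∈ Y := by
  have h1 := (CodingState.inv_evolve L F D s hq t).complete k
  have hset : {j | k ∉ D.status (L k) s k t j ∧ j ∉ (∅ : Set (Fin (L k)))} = ∅ := by
    ext j
    simp [hfin j]
  rw [CodingState.reach, hset, Set.image_empty, Submodule.span_empty, sup_bot_eq] at h1
  exact CodingState.known_evolve_le L F D s k t Y h (h1 (Submodule.subset_span ⟨j, rfl⟩))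

end Coding

/-! ### A linear network code from a schedule -/

/-- An infinite sequence of reception sets that continues a finite one by empty sets. -/
def extendHistory {K n : ℕ} (h : Fin n → Finset (Fin K)) (t : ℕ) : Finset (Fin K) :=
  if ht : t < n then h ⟨t, ht⟩ else ∅

lemma extendHistory_of_lt {K n : ℕ} (h : Fin n → Finset (Fin K)) {t : ℕ} (ht : t < n) :
    extendHistory h t = h ⟨t, ht⟩ := dif_pos ht

/-- The first `m` terms of a sequence of reception sets. -/
def history {K : ℕ} (s : ℕ → Finset (Fin K)) (m : ℕ) : Fin m → Finset (Fin K) := fun t => s t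

/-- The value of the linear functional with coefficient vector `v` on the information symbols. -/
def pairing {K : ℕ} {L : Fin K → ℕ} {F : Type} [Field F] (v X : Messages L F) : F :=
  ∑ k, ∑ j, v k j * X k j

section

variable {K : ℕ} {L : Fin K → ℕ} {F : Type} [Field F]

lemma pairing_single (k : Fin K) (j : Fin (L k)) (X : Messages L F) :
    pairing (Pi.single k (Pi.single j 1)) X = X k j := by
  classical
  rw [pairing, sum_eq_single k, sum_eq_single j]
  · simp
  · intro i _ hi
    simp [hi]
  · simp
  · intro i _ hi
    simp [hi]
  · simp

/-- The coefficient vectors on which two message vectors agree. -/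
def agreeSpace (X X' : Messages L F) : Submodule F (Messages L F) where
  carrier := {v | pairing v X = pairing v X'}
  zero_mem' := by simp [pairing]
  add_mem' {v w} hv hw := by
    simp only [pairing, Set.mem_ofPred_eq, Pi.add_apply, add_mul, sum_add_distrib] at *
    rw [hv, hw]
  smul_mem' c v hv := by
    simp only [pairing, Set.mem_ofPred_eq, Pi.smul_apply, smul_eq_mul, mul_assoc, ← mul_sum] at *
    rw [hv]

lemma mem_agreeSpace {X X' v : Messages L F} :
    v ∈ agreeSpace X X' ↔ pairing v X = pairing v X' := Iff.rfl

lemma pairing_comm (v X : Messages L F) : pairing v X = pairing X v := by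
  simp only [pairing, mul_comm]

/-- At most a fraction `1 / q` of all message vectors have symbols that add up to zero. -/
lemma card_pairing_one_eq_zero [Fintype F] [DecidableEq F] {k : Fin K} (hk : 0 < L k) :
    #{X : Messages L F | pairing (fun _ _ => 1) X = 0} * Fintype.card F ≤
      Fintype.card (Messages L F) := by
  classical
  rw [← card_univ (α := F), ← card_product, ← card_univ]
  -- Adding `c` to one symbol of `X` shifts the sum by `c`, so `(X, c)` can be recovered.
  refine card_le_card_of_injOn
    (fun a => a.1 + a.2 • (Pi.single k (Pi.single ⟨0, hk⟩ 1) : Messages L F)) (by simp) ?_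
  have hadd : ∀ (X : Messages L F) (c : F),
      pairing (fun _ _ => 1) (X + c • (Pi.single k (Pi.single ⟨0, hk⟩ 1) : Messages L F)) =
        pairing (fun _ _ => 1) X + c := by
    intro X c
    have h1 : pairing (fun _ _ => 1) (Pi.single k (Pi.single ⟨0, hk⟩ 1) : Messages L F) = 1 := by
      rw [pairing_comm, pairing_single]
    simp only [pairing, Pi.add_apply, Pi.smul_apply, smul_eq_mul, one_mul, sum_add_distrib,
      ← mul_sum] at h1 ⊢
    rw [h1, mul_one]
  rintro ⟨X, c⟩ hX ⟨Y, d⟩ hY h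
  have hX' : pairing (fun _ _ => 1) X = 0 := by simpa using hX
  have hY' : pairing (fun _ _ => 1) Y = 0 := by simpa using hY
  simp only at h
  have hcd : c = d := by
    have := congrArg (pairing fun _ _ => 1) h
    rwa [hadd, hadd, hX', hY', zero_add, zero_add] at this
  subst hcd
  rw [add_left_inj] at h
  rw [h]

variable (L)

/-- The coding vectors of the full code. Packet evolution runs up to slot `n₁`. After that, the sum
of all information symbols is sent as it is up to slot `n₂` and finally multiplied by a label
`β` of the first `n₁` reception sets, so that a receiver that has seen both can tell the label. -/
def labelledVector (D : Schedule K) {n₁ : ℕ} (n₂ : ℕ) (β : (Fin n₁ → Finset (Fin K)) → F)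
    (s : ℕ → Finset (Fin K)) (t : ℕ) : Messages L F :=
  if t < n₁ then CodingState.sent L F D s t
  else if t < n₂ then fun _ _ => 1
  else fun _ _ => β (history s n₁)

lemma labelledVector_congr (D : Schedule K) {n₁ : ℕ} (n₂ : ℕ)
    (β : (Fin n₁ → Finset (Fin K)) → F) {s s' : ℕ → Finset (Fin K)} {t : ℕ}
    (h : ∀ τ < t, s τ = s' τ) : labelledVector L D n₂ β s t = labelledVector L D n₂ β s' t := by
  unfold labelledVector
  split_ifs with h1 h2
  · exact CodingState.sent_congr L F D h
  · rfl
  · have : history s n₁ = history s' n₁ := funext fun τ => h τ (by omega)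
    rw [this]

/-- The encoder that sends the vectors `v t h` after the reception history `h`. -/
def linearEncoder {n : ℕ} (v : (t : Fin n) → (Fin t → Finset (Fin K)) → Messages L F) (t : Fin n)
    (X : Messages L F) (z : Fin t → Fin K → Option F) : F :=
  pairing (v t fun τ => ({i | (z τ i).isSome} : Finset (Fin K))) X

lemma output_linearEncoder {n : ℕ}
    (v : (t : Fin n) → (Fin t → Finset (Fin K)) → Messages L F)
    (dec : (k : Fin K) → (Fin n → Option F) → (Fin (L k) → F)) (X : Messages L F)
    (s : Fin n → Finset (Fin K)) (t : Fin n) (k : Fin K) :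
    (FeedbackCode.mk (linearEncoder L v) dec).output X s t k =
      if k ∈ s t then
        some (pairing (v t fun τ => s ⟨τ, τ.2.trans t.2⟩) X) else none := by
  rw [FeedbackCode.output]
  congr 2
  simp only [linearEncoder]
  congr 2
  funext τ
  ext i
  rw [mem_filter, FeedbackCode.output]
  split_ifs with h <;> simp [h]

variable {L}

/-- A sequence of reception sets lets receiver `k` decode: all packets of session `k` are finished
before slot `n₁`, and the receiver is reached in each of the two blocks of slots that follow. -/
structure Decodable (D : Schedule K) (m n₁ n₂ n : ℕ) (k : Fin K) (s : Fin n → Finset (Fin K)) :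
    Prop where
  finished : ∀ j, k ∈ D.status m (extendHistory s) k n₁ j
  plain : ∃ t : Fin n, n₁ ≤ t ∧ (t : ℕ) < n₂ ∧ k ∈ s t
  labelled : ∃ t : Fin n, n₁ ≤ t ∧ n₂ ≤ (t : ℕ) ∧ k ∈ s t

/-- The outputs at a receiver determine its symbols, because the two blocks reveal the label of the
reception history and with it all coding vectors. -/
lemma Decodable.messages_eq [Fintype F] {D : Schedule K} {n₁ n₂ n : ℕ} (h₁ : n₁ ≤ n)
    {β : (Fin n₁ → Finset (Fin K)) → F} (hβ : Function.Injective β) (hq : K ≤ Fintype.card F)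
    {k : Fin K} {s s' : Fin n → Finset (Fin K)} {X X' : Messages L F}
    (hs : Decodable D (L k) n₁ n₂ n k s) (hX : pairing (fun _ _ => 1) X ≠ 0)
    (hout : ∀ t : Fin n,
      (if k ∈ s t then some (pairing (labelledVector L D n₂ β (extendHistory s) t) X) else none) =
      (if k ∈ s' t then some (pairing (labelledVector L D n₂ β (extendHistory s') t) X')
        else none)) : X k = X' k := by
  have hval : ∀ t : Fin n, k ∈ s t →
      pairing (labelledVector L D n₂ β (extendHistory s) t) X =
        pairing (labelledVector L D n₂ β (extendHistory s') t) X' := by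
    intro t ht
    have h := hout t
    rw [if_pos ht] at h
    split_ifs at h with h'
    exact Option.some.inj h
  have hsum : pairing (fun _ _ => 1) X = pairing (fun _ _ => 1) X' := by
    obtain ⟨t, ht1, ht2, ht⟩ := hs.plain
    have h := hval t ht
    simpa only [labelledVector, if_neg ht1.not_gt, if_pos ht2] using h
  have hlabel : history (extendHistory s) n₁ = history (extendHistory s') n₁ := by
    obtain ⟨t, ht1, ht2, ht⟩ := hs.labelled
    have h := hval t ht
    have hconst : ∀ (b : F) (Y : Messages L F),
        pairing (fun _ _ => b) Y = b * pairing (fun _ _ => 1) Y := by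
      intro b Y
      simp [pairing, mul_sum]
    simp only [labelledVector, if_neg ht1.not_gt, if_neg ht2.not_gt] at h
    rw [hconst, hconst (β (history (extendHistory s') n₁)), ← hsum] at h
    exact hβ (mul_right_cancel₀ hX h)
  have hagree : ∀ τ < n₁, extendHistory s τ = extendHistory s' τ := fun τ hτ =>
    congrFun hlabel ⟨τ, hτ⟩
  funext j
  have hmem := single_mem_of_finished D (extendHistory s) hq hs.finished (agreeSpace X X')
    (fun τ hτ hk => by
      have hτn : τ < n := hτ.trans_le h₁
      rw [extendHistory_of_lt s hτn] at hk
      have h := hval ⟨τ, hτn⟩ hk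
      rw [labelledVector_congr L D n₂ β (fun i hi => (hagree i (hi.trans hτ)).symm)] at h
      rw [mem_agreeSpace]
      simpa only [labelledVector, if_pos hτ] using h) j
  rwa [mem_agreeSpace, pairing_single, pairing_single] at hmem

open Classical in
/-- Every schedule gives a linear network code: a receiver fails only if the reception sets are not
decodable for it or if the information symbols add up to zero. -/
theorem exists_linear_code [Fintype F] (D : Schedule K) (L : Fin K → ℕ) {n₁ n₂ n : ℕ}
    (h₁ : n₁ ≤ n) (hq : K ≤ Fintype.card F)
    (hlabels : Fintype.card (Fin n₁ → Finset (Fin K)) ≤ Fintype.card F) :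
    ∃ c : FeedbackCode n L F, c.IsLinear ∧ ∀ (P : BroadcastPEC K) (k : Fin K), 0 < L k →
      c.errorProb P k ≤ ∑ s : Fin n → Finset (Fin K), (∏ t, P.p (s t)) *
        ((if Decodable D (L k) n₁ n₂ n k s then 0 else 1) + 1 / (Fintype.card F : ℝ)) := by
  obtain ⟨β⟩ := Function.Embedding.nonempty_of_card_le hlabels
  let v : (t : Fin n) → (Fin t → Finset (Fin K)) → Messages L F := fun t h =>
    labelledVector L D n₂ β (extendHistory h) t
  let out : Messages L F → (Fin n → Finset (Fin K)) → Fin K → Fin n → Option F := fun X s k t =>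
    if k ∈ s t then some (pairing (labelledVector L D n₂ β (extendHistory s) t) X) else none
  -- The decoder picks any messages and decodable reception sets that explain what it sees.
  let dec : (k : Fin K) → (Fin n → Option F) → (Fin (L k) → F) := fun k z =>
    if h : ∃ a : Messages L F × (Fin n → Finset (Fin K)),
        Decodable D (L k) n₁ n₂ n k a.2 ∧ pairing (fun _ _ => 1) a.1 ≠ 0 ∧ out a.1 a.2 k = z
    then h.choose.1 k else 0
  let c : FeedbackCode n L F := ⟨linearEncoder L v, dec⟩
  have hout : ∀ X s k, (fun t => c.output X s t k) = out X s k := by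
    intro X s k
    funext t
    have hv : (v t fun τ => s ⟨τ, τ.2.trans t.2⟩) =
        labelledVector L D n₂ β (extendHistory s) t := by
      refine labelledVector_congr L D n₂ β fun τ hτ => ?_
      rw [extendHistory_of_lt _ hτ, extendHistory_of_lt s (hτ.trans t.2)]
    rw [output_linearEncoder L v dec X s t k, hv]
  have hdec : ∀ X s k, Decodable D (L k) n₁ n₂ n k s → pairing (fun _ _ => 1) X ≠ 0 →
      c.decoded X s k = X k := by
    intro X s k hs hX
    have hex : ∃ a : Messages L F × (Fin n → Finset (Fin K)),
        Decodable D (L k) n₁ n₂ n k a.2 ∧ pairing (fun _ _ => 1) a.1 ≠ 0 ∧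
          out a.1 a.2 k = out X s k := ⟨(X, s), hs, hX, rfl⟩
    have hd : c.decoded X s k = hex.choose.1 k := by
      rw [FeedbackCode.decoded, hout]
      exact dif_pos hex
    rw [hd]
    obtain ⟨h1, h2, h3⟩ := hex.choose_spec
    exact h1.messages_eq h₁ β.injective hq h2 (congrFun h3)
  refine ⟨c, ⟨fun t h => v t h, fun t X z => rfl⟩, fun P k hk => ?_⟩
  refine sum_le_sum fun s _ => mul_le_mul_of_nonneg_left ?_ (prod_nonneg fun t _ => P.p_nonneg _)
  have hV : (0 : ℝ) < Fintype.card (Messages L F) := by exact_mod_cast Fintype.card_pos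
  have hF : (0 : ℝ) < Fintype.card F := by exact_mod_cast Fintype.card_pos
  split_ifs with hs
  · rw [zero_add, div_le_div_iff₀ hV hF, one_mul]
    refine le_trans ?_ (Nat.cast_le.2 (card_pairing_one_eq_zero (F := F) (L := L) hk))
    push_cast
    refine mul_le_mul_of_nonneg_right (Nat.cast_le.2 (card_le_card ?_)) hF.le
    intro X hX
    simp only [mem_filter, mem_univ, true_and] at hX ⊢
    by_contra hX0
    exact hX (hdec X s k hs hX0)
  · refine le_trans ?_ (le_add_of_nonneg_right (by positivity))
    rw [div_le_one hV]
    exact_mod_cast card_le_univ _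

end

lemma FeedbackCode.errorProb_eq_zero {K n : ℕ} {L : Fin K → ℕ} {F : Type} [Fintype F]
    (c : FeedbackCode n L F) (P : BroadcastPEC K) {k : Fin K} (hk : L k = 0) :
    c.errorProb P k = 0 := by
  have : IsEmpty (Fin (L k)) := by rw [hk]; infer_instance
  refine sum_eq_zero fun s _ => ?_
  have h0 : ∀ X : Messages L F, c.decoded X s k = X k := fun X => Subsingleton.elim _ _
  simp [h0]

/-! ### A large deviation bound for the channel -/

namespace BroadcastPEC

variable {K : ℕ} (P : BroadcastPEC K)

open Classical in
/-- The probability of a set of reception sequences of length `n`. -/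
def prob (n : ℕ) (E : (Fin n → Finset (Fin K)) → Prop) : ℝ :=
  ∑ s : Fin n → Finset (Fin K), (∏ t, P.p (s t)) * if E s then 1 else 0

lemma prod_p_nonneg {n : ℕ} (s : Fin n → Finset (Fin K)) : 0 ≤ ∏ t, P.p (s t) :=
  prod_nonneg fun _ _ => P.p_nonneg _

lemma sum_prod_p_mul_prod {n : ℕ} (f : Fin n → Finset (Fin K) → ℝ) :
    ∑ s : Fin n → Finset (Fin K), (∏ t, P.p (s t)) * ∏ t, f t (s t) =
      ∏ t, ∑ A, P.p A * f t A := by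
  simp_rw [← prod_mul_distrib]
  exact (Fintype.prod_sum fun t A => P.p A * f t A).symm

lemma sum_prod_p (n : ℕ) : ∑ s : Fin n → Finset (Fin K), ∏ t, P.p (s t) = 1 := by
  have h := P.sum_prod_p_mul_prod (n := n) fun _ _ => 1
  simpa [P.p_sum] using h

lemma prob_mono {n : ℕ} {E E' : (Fin n → Finset (Fin K)) → Prop} (h : ∀ s, E s → E' s) :
    P.prob n E ≤ P.prob n E' := by
  classical
  refine sum_le_sum fun s _ => mul_le_mul_of_nonneg_left ?_ (P.prod_p_nonneg s)
  by_cases hE : E s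
  · rw [if_pos hE, if_pos (h s hE)]
  · rw [if_neg hE]
    split_ifs <;> norm_num

lemma prob_or_le {n : ℕ} (E E' : (Fin n → Finset (Fin K)) → Prop) :
    P.prob n (fun s => E s ∨ E' s) ≤ P.prob n E + P.prob n E' := by
  classical
  unfold prob
  rw [← sum_add_distrib]
  refine sum_le_sum fun s _ => ?_
  rw [← mul_add]
  refine mul_le_mul_of_nonneg_left ?_ (P.prod_p_nonneg s)
  by_cases hE : E s <;> by_cases hE' : E' s <;> simp [hE, hE']

lemma prob_exists_le {n : ℕ} {ι : Type*} (I : Finset ι)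
    (E : ι → (Fin n → Finset (Fin K)) → Prop) :
    P.prob n (fun s => ∃ i ∈ I, E i s) ≤ ∑ i ∈ I, P.prob n (E i) := by
  classical
  induction I using Finset.induction_on with
  | empty => simp [prob]
  | insert a I ha ih =>
    rw [sum_insert ha]
    refine le_trans (P.prob_mono fun s hs => ?_)
      ((P.prob_or_le (E a) fun s => ∃ i ∈ I, E i s).trans (add_le_add_right ih _))
    simpa using hs

/-- Chernoff's bound for a sum of independent bounded functions of the reception sets. -/
theorem prob_sum_ge_le {n : ℕ} (g : Fin n → Finset (Fin K) → ℝ) {c δ μ : ℝ} (hc : 0 < c)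
    (hg : ∀ t A, |g t A| ≤ c) (hδ : 0 < δ) (hδc : δ ≤ c)
    (hμ : ∑ t, ∑ A, P.p A * g t A ≤ μ) :
    P.prob n (fun s => μ + δ * n ≤ ∑ t, g t (s t)) ≤ Real.exp (-(δ ^ 2 / (4 * c ^ 2)) * n) := by
  classical
  set l : ℝ := δ / (2 * c ^ 2) with hl
  have hl0 : 0 < l := by positivity
  have hlc : l * c ≤ 1 := by
    have : l * c = δ / (2 * c) := by rw [hl]; field_simp
    rw [this, div_le_one (by positivity)]
    linarith
  have hstep : ∀ t, ∑ A, P.p A * Real.exp (l * g t A) ≤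
      Real.exp (l * (∑ A, P.p A * g t A) + (l * c) ^ 2) := by
    intro t
    have h1 : ∀ A, Real.exp (l * g t A) ≤ 1 + l * g t A + (l * c) ^ 2 := by
      intro A
      have hab : |l * g t A| ≤ l * c := by
        rw [abs_mul, abs_of_pos hl0]
        exact mul_le_mul_of_nonneg_left (hg t A) hl0.le
      have h2 := (abs_le.1 (Real.abs_exp_sub_one_sub_id_le (hab.trans hlc))).2
      have h3 : (l * g t A) ^ 2 ≤ (l * c) ^ 2 := sq_le_sq' (abs_le.1 hab).1 (abs_le.1 hab).2
      linarith
    calc ∑ A, P.p A * Real.exp (l * g t A)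
        ≤ ∑ A, P.p A * (1 + l * g t A + (l * c) ^ 2) :=
          sum_le_sum fun A _ => mul_le_mul_of_nonneg_left (h1 A) (P.p_nonneg A)
      _ = l * (∑ A, P.p A * g t A) + (l * c) ^ 2 + 1 := by
          have h4 : ∀ A, P.p A * (1 + l * g t A + (l * c) ^ 2) =
              P.p A + l * (P.p A * g t A) + P.p A * (l * c) ^ 2 := fun A => by ring
          simp_rw [h4, sum_add_distrib, ← mul_sum, ← sum_mul, P.p_sum]
          ring
      _ ≤ _ := Real.add_one_le_exp _
  have hmarkov : P.prob n (fun s => μ + δ * n ≤ ∑ t, g t (s t)) ≤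
      Real.exp (-(l * (μ + δ * n))) * ∏ t, ∑ A, P.p A * Real.exp (l * g t A) := by
    rw [← P.sum_prod_p_mul_prod fun t A => Real.exp (l * g t A), mul_sum]
    refine sum_le_sum fun s _ => ?_
    rw [mul_left_comm]
    refine mul_le_mul_of_nonneg_left ?_ (P.prod_p_nonneg s)
    rw [← Real.exp_sum, ← Real.exp_add, ← mul_sum]
    split_ifs with h
    · rw [← Real.exp_zero]
      refine Real.exp_le_exp.2 ?_
      have := mul_le_mul_of_nonneg_left h hl0.le
      linarith
    · exact (Real.exp_pos _).le
  refine hmarkov.trans ?_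
  calc _ ≤ Real.exp (-(l * (μ + δ * n))) *
        ∏ t, Real.exp (l * (∑ A, P.p A * g t A) + (l * c) ^ 2) :=
        mul_le_mul_of_nonneg_left (prod_le_prod (fun t _ => sum_nonneg fun A _ =>
          mul_nonneg (P.p_nonneg A) (Real.exp_pos _).le) fun t _ => hstep t) (Real.exp_pos _).le
    _ ≤ _ := by
        rw [← Real.exp_sum, ← Real.exp_add]
        refine Real.exp_le_exp.2 ?_
        rw [sum_add_distrib, ← mul_sum, sum_const, card_univ, Fintype.card_fin, nsmul_eq_mul]
        have h1 := mul_le_mul_of_nonneg_left hμ hl0.le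
        have h2 : l * δ - (l * c) ^ 2 = δ ^ 2 / (4 * c ^ 2) := by
          rw [hl]; field_simp; ring
        rw [← h2]
        linarith

end BroadcastPEC

/-! ### Counting packets -/

/-- A queue with at most one departure per slot, and no arrival in a slot with a departure: its
length is bounded by the net input since the start or since some earlier slot with a departure. -/
lemma queue_le_net_input {r a d : ℕ → ℕ} {T : ℕ} (h : ∀ t < T, r (t + 1) ≤ r t - d t + a t)
    (hd : ∀ t, d t ≤ 1) (had : ∀ t, d t = 1 → a t = 0) :
    (r T : ℤ) ≤ r 0 + ∑ t ∈ range T, ((a t : ℤ) - d t) ∨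
      ∃ τ < T, d τ = 1 ∧ (r T : ℤ) ≤ ∑ t ∈ Ico (τ + 1) T, ((a t : ℤ) - d t) := by
  induction T with
  | zero => simp
  | succ T ih =>
    have hT := h T (Nat.lt_succ_self T)
    by_cases hr : d T ≤ r T
    · rcases ih fun t ht => h t (ht.trans (Nat.lt_succ_self T)) with h1 | ⟨τ, hτ, hdτ, h1⟩
      · left
        rw [sum_range_succ]
        omega
      · right
        refine ⟨τ, hτ.trans (Nat.lt_succ_self T), hdτ, ?_⟩
        rw [sum_Ico_succ_top (by omega)]
        omega
    · right
      have h1 := hd T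
      have h2 : d T = 1 := by omega
      have h3 := had T h2
      refine ⟨T, Nat.lt_succ_self T, h2, ?_⟩
      rw [Ico_self, sum_empty]
      omega

namespace Schedule

variable {K : ℕ} (D : Schedule K) (m : ℕ) (s : ℕ → Finset (Fin K)) (k : Fin K)

open Classical in
/-- The number of packets of session `k` with status `S` before slot `t`. -/
def queue (S : Finset (Fin K)) (t : ℕ) : ℕ := #{j | D.status m s k t j = S}

open Classical in
/-- The number of unfinished packets of session `k` before slot `t`. -/
def unfinished (t : ℕ) : ℕ := #{j | k ∉ D.status m s k t j}

open Classical in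
/-- Indicator that a packet of status `S` would lose this status in slot `t`. -/
def departure (S : Finset (Fin K)) (t : ℕ) : ℕ := if D.elig t k S ∧ ¬ s t ⊆ S then 1 else 0

open Classical in
/-- Indicator that an eligible packet would get status `S` in slot `t`. -/
def arrival (S : Finset (Fin K)) (t : ℕ) : ℕ :=
  if ∃ S₁, D.elig t k S₁ ∧ ¬ s t ⊆ S₁ ∧ D.mix t \ {k} ∪ s t = S then 1 else 0

variable {D k}

lemma status_succ_of_pick {t : ℕ} {j : Fin m} (h : D.pick t k (D.status m s k t) = some j)
    (hA : ¬ s t ⊆ D.status m s k t j) (i : Fin m) : D.status m s k (t + 1) i =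
      if i = j then D.mix t \ {k} ∪ s t else D.status m s k t i := by
  rw [status_succ]
  by_cases hij : i = j
  · subst hij
    rw [if_pos ⟨h, hA⟩, if_pos rfl]
  · rw [if_neg, if_neg hij]
    rintro ⟨h', -⟩
    exact hij (Option.some.inj (h'.symm.trans h))

lemma queue_succ_le (S : Finset (Fin K)) (t : ℕ)
    (huniq : ∀ S₁ S₂, D.elig t k S₁ → D.elig t k S₂ → S₁ = S₂) :
    D.queue m s k S (t + 1) ≤
      D.queue m s k S t - D.departure s k S t + D.arrival s k S t := by
  classical
  by_cases hp : ∃ j, D.pick t k (D.status m s k t) = some j ∧ ¬ s t ⊆ D.status m s k t j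
  · obtain ⟨j, hj, hA⟩ := hp
    have hel := D.elig_of_pick hj
    by_cases hS : D.status m s k t j = S
    · have hsub : ({i | D.status m s k (t + 1) i = S} : Finset (Fin m)) ⊆
          ({i | D.status m s k t i = S} : Finset (Fin m)).erase j ∪
            if D.mix t \ {k} ∪ s t = S then {j} else ∅ := by
        intro i hi
        simp only [mem_filter, mem_univ, true_and] at hi
        rw [status_succ_of_pick m s hj hA] at hi
        split_ifs at hi with hij
        · subst hij
          simp [hi]
        · simp [hij, hi]
      have hdep : D.departure s k S t = 1 := if_pos ⟨hS ▸ hel, hS ▸ hA⟩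
      have hcard := (card_le_card hsub).trans (card_union_le _ _)
      rw [card_erase_of_mem (by simp [hS])] at hcard
      rw [hdep]
      refine hcard.trans (add_le_add le_rfl ?_)
      split_ifs with h2
      · rw [card_singleton, arrival, if_pos ⟨_, hel, hA, h2⟩]
      · simp
    · have hsub : ({i | D.status m s k (t + 1) i = S} : Finset (Fin m)) ⊆
          ({i | D.status m s k t i = S} : Finset (Fin m)) ∪
            if D.mix t \ {k} ∪ s t = S then {j} else ∅ := by
        intro i hi
        simp only [mem_filter, mem_univ, true_and] at hi
        rw [status_succ_of_pick m s hj hA] at hi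
        split_ifs at hi with hij
        · subst hij
          simp [hi]
        · simp [hi]
      have hdep : D.departure s k S t = 0 := if_neg fun h => hS (huniq _ _ hel h.1)
      have hcard := (card_le_card hsub).trans (card_union_le _ _)
      rw [hdep]
      refine hcard.trans (add_le_add le_rfl ?_)
      split_ifs with h2
      · rw [card_singleton, arrival, if_pos ⟨_, hel, hA, h2⟩]
      · simp
  · have hstat : D.status m s k (t + 1) = D.status m s k t := by
      funext j
      rw [status_succ, if_neg fun h => hp ⟨j, h⟩]
    have hq : D.queue m s k S (t + 1) = D.queue m s k S t := by rw [queue, hstat, queue]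
    rw [hq]
    unfold departure
    split_ifs with hd
    · -- In an idle slot the eligible queue is empty.
      have hzero : D.queue m s k S t = 0 := by
        rw [queue, card_eq_zero, filter_eq_empty_iff]
        intro j _ hj
        have hel : D.elig t k (D.status m s k t j) := hj ▸ hd.1
        obtain ⟨i, hi⟩ := D.exists_pick hel
        have := huniq _ _ hd.1 (D.elig_of_pick hi)
        exact hp ⟨i, hi, this ▸ hd.2⟩
      omega
    · omega

open Classical in
/-- In a slot in which all unfinished packets are eligible, one of them is finished if the receiver
is reached; the number of unfinished packets never grows. -/
lemma unfinished_succ_le (t : ℕ) : D.unfinished m s k (t + 1) ≤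
    D.unfinished m s k t - if (∀ S, k ∉ S → D.elig t k S) ∧ k ∈ s t then 1 else 0 := by
  have hsub : ({j | k ∉ D.status m s k (t + 1) j} : Finset (Fin m)) ⊆
      ({j | k ∉ D.status m s k t j} : Finset (Fin m)) := by
    intro j hj
    simp only [mem_filter, mem_univ, true_and] at hj ⊢
    rw [status_succ] at hj
    split_ifs at hj with h
    · exact (D.valid _ _ _ (D.elig_of_pick h.1)).2.2
    · exact hj
  split_ifs with hc
  · by_cases h0 : ∃ j, k ∉ D.status m s k t j
    · obtain ⟨j, hj⟩ := h0
      obtain ⟨i, hi⟩ := D.exists_pick (hc.1 _ hj)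
      have hik := (D.valid _ _ _ (D.elig_of_pick hi)).2.2
      have hA : ¬ s t ⊆ D.status m s k t i := fun h => hik (h hc.2)
      have hmem : i ∈ ({j | k ∉ D.status m s k t j} : Finset (Fin m)) := by simp [hik]
      unfold unfinished
      rw [← card_erase_of_mem hmem]
      refine card_le_card fun l hl => mem_erase.2 ⟨?_, hsub hl⟩
      rintro rfl
      simp only [mem_filter, mem_univ, true_and] at hl
      rw [status_succ_of_pick m s hi hA, if_pos rfl] at hl
      exact hl (mem_union_right _ hc.2)
    · have : D.unfinished m s k (t + 1) ≤ D.unfinished m s k t := card_le_card hsub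
      have h1 : D.unfinished m s k t = 0 := by
        rw [unfinished, card_eq_zero, filter_eq_empty_iff]
        exact fun j _ hj => h0 ⟨j, hj⟩
      omega
  · exact card_le_card hsub

open Classical in
lemma unfinished_le_sub {t₀ t₁ : ℕ} (h : t₀ ≤ t₁) : D.unfinished m s k t₁ ≤
    D.unfinished m s k t₀ - #{t ∈ Ico t₀ t₁ | (∀ S, k ∉ S → D.elig t k S) ∧ k ∈ s t} := by
  induction t₁, h using Nat.le_induction with
  | base => simp
  | succ t ht ih =>
    have h1 := D.unfinished_succ_le (k := k) m s t
    rw [← insert_Ico_right_eq_Ico_add_one ht, filter_insert]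
    split_ifs at h1 ⊢ with hc
    · rw [card_insert_of_notMem (by simp)]
      omega
    · omega

open Classical in
lemma unfinished_le_sum_queue (t : ℕ) :
    D.unfinished m s k t ≤ ∑ S with k ∉ S, D.queue m s k S t := by
  unfold unfinished queue
  rw [card_eq_sum_card_fiberwise (f := D.status m s k t) (t := {S | k ∉ S}) (by
    intro j hj
    simpa using hj)]
  refine sum_le_sum fun S _ => card_le_card ?_
  intro j hj
  simp only [mem_filter, mem_univ, true_and] at hj ⊢
  exact hj.2

end Schedule

/-! ### Fluid balance of the linear program -/

section Balance

variable {K : ℕ}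

lemma subset_univ_sdiff_singleton {k : Fin K} {S : Finset (Fin K)} :
    S ⊆ univ \ {k} ↔ k ∉ S := by
  rw [subset_sdiff, disjoint_singleton_right]
  simp

open Classical in
/-- The stages of session `k`. In stage `(S, T)`, packets of status `S` are sent in mixtures of the
sessions `T ∪ {k}`. -/
def stages (k : Fin K) : Finset (Finset (Fin K) × Finset (Fin K)) := {a | a.2 ⊆ a.1 ∧ k ∉ a.1}

lemma mem_stages {k : Fin K} {a : Finset (Fin K) × Finset (Fin K)} :
    a ∈ stages k ↔ a.2 ⊆ a.1 ∧ k ∉ a.1 := by simp [stages]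

/-- The net number of packets that gain status `S` in a slot of stage `a` in which a packet is sent
and exactly the receivers in `A` are reached. -/
def gain (S : Finset (Fin K)) (a : Finset (Fin K) × Finset (Fin K)) (A : Finset (Fin K)) : ℝ :=
  (if ¬ A ⊆ a.1 ∧ a.2 ∪ A = S then 1 else 0) - if a.1 = S ∧ ¬ A ⊆ S then 1 else 0

lemma abs_gain_le (S : Finset (Fin K)) (a : Finset (Fin K) × Finset (Fin K))
    (A : Finset (Fin K)) : |gain S a A| ≤ 1 := by
  unfold gain
  split_ifs <;> norm_num

variable (P : BroadcastPEC K)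

/-- The expectation of `gain`. -/
def drift (S : Finset (Fin K)) (a : Finset (Fin K) × Finset (Fin K)) : ℝ :=
  ∑ A, P.p A * gain S a A

lemma abs_drift_le (S : Finset (Fin K)) (a : Finset (Fin K) × Finset (Fin K)) :
    |drift P S a| ≤ 1 := by
  refine (abs_sum_le_sum_abs _ _).trans ?_
  rw [← P.p_sum]
  refine sum_le_sum fun A _ => ?_
  rw [abs_mul, abs_of_nonneg (P.p_nonneg A)]
  exact mul_le_of_le_one_right (P.p_nonneg A) (abs_gain_le S a A)

lemma drift_eq (S : Finset (Fin K)) {a : Finset (Fin K) × Finset (Fin K)} (ha : a.2 ⊆ a.1) :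
    drift P S a = (if a.2 ⊆ S ∧ ¬ S ⊆ a.1 then P.fp (S \ a.2) (univ \ S) else 0) -
      if a.1 = S then P.pUnion (univ \ S) else 0 := by
  unfold drift gain
  simp_rw [mul_sub, sum_sub_distrib, mul_ite, mul_one, mul_zero, ← sum_filter]
  congr 1
  · split_ifs with h
    · unfold BroadcastPEC.fp
      congr 1
      ext A
      simp only [mem_filter, mem_univ, true_and]
      constructor
      · rintro ⟨-, rfl⟩
        refine ⟨fun i hi => ?_, fun i hi => ?_⟩
        · simp only [mem_sdiff, mem_union] at hi
          tauto
        · simp only [mem_sdiff, mem_univ, mem_union, true_and] at hi ⊢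
          tauto
      · rintro ⟨h1, h2⟩
        have hAS : A ⊆ S := by
          intro i hi
          by_contra hiS
          exact (mem_sdiff.1 (h2 (by simp [hiS]))).2 hi
        have heq : a.2 ∪ A = S := by
          refine (union_subset h.1 hAS).antisymm fun i hi => ?_
          by_cases hia : i ∈ a.2
          · exact mem_union_left _ hia
          · exact mem_union_right _ (h1 (mem_sdiff.2 ⟨hi, hia⟩))
        refine ⟨fun hA => h.2 ?_, heq⟩
        rw [← heq]
        exact union_subset ha hA
    · refine sum_eq_zero fun A hA => ?_
      simp only [mem_filter, mem_univ, true_and] at hA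
      obtain ⟨h1, rfl⟩ := hA
      exact absurd ⟨subset_union_left, fun h2 => h1 (subset_union_right.trans h2)⟩ h
  · split_ifs with h
    · unfold BroadcastPEC.pUnion
      congr 1
      ext A
      simp only [mem_filter, mem_univ, true_and, h]
      rw [← sdiff_nonempty, ← compl_eq_univ_sdiff, sdiff_eq_inter_compl]
    · simp [h]

/-- The order in which the stages of session `k` are run: by the set of mixed sessions, and then by
the status of the packets that are sent. -/
def Before (prec : Finset (Fin K) → Finset (Fin K) → Prop) (k : Fin K)
    (a b : Finset (Fin K) × Finset (Fin K)) : Prop :=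
  prec (a.2 ∪ {k}) (b.2 ∪ {k}) ∨ (a.2 = b.2 ∧ prec a.1 b.1)

open Classical in
/-- The stages of session `k` that come after stage `b`. -/
def stagesAfter (prec : Finset (Fin K) → Finset (Fin K) → Prop) (k : Fin K)
    (b : Finset (Fin K) × Finset (Fin K)) : Finset (Finset (Fin K) × Finset (Fin K)) :=
  {a ∈ stages k | ¬ (Before prec k a b ∨ a = b)}

variable {P} {prec : Finset (Fin K) → Finset (Fin K) → Prop} {R : Fin K → ℝ}
  {x : Finset (Fin K) → ℝ} {w : Fin K → Finset (Fin K) → Finset (Fin K) → ℝ}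

lemma sum_stages_drift (P : BroadcastPEC K)
    (w : Fin K → Finset (Fin K) → Finset (Fin K) → ℝ) {k : Fin K} (S : Finset (Fin K))
    {I : Finset (Finset (Fin K) × Finset (Fin K))} (hI : I ⊆ stages k) :
    ∑ a ∈ I, w k a.1 a.2 * drift P S a =
      (∑ a ∈ I with a.2 ⊆ S ∧ ¬ S ⊆ a.1, w k a.1 a.2 * P.fp (S \ a.2) (univ \ S)) -
        (∑ a ∈ I with a.1 = S, w k a.1 a.2) * P.pUnion (univ \ S) := by
  classical
  rw [sum_filter, sum_filter, sum_mul, ← sum_sub_distrib]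
  refine sum_congr rfl fun a ha => ?_
  rw [drift_eq P S (mem_stages.1 (hI ha)).1, mul_sub]
  congr 1
  · split_ifs <;> simp
  · split_ifs <;> simp

lemma sum_snd_eq {ι : Type*} [Fintype ι] [DecidableEq ι] (S : ι) (Q : ι × ι → Prop)
    [DecidablePred Q] (f : ι → ι → ℝ) :
    ∑ a : ι × ι with a.1 = S ∧ Q a, f a.1 a.2 = ∑ T with Q (S, T), f S T := by
  refine sum_nbij' (fun a => a.2) (fun T => (S, T)) ?_ ?_ ?_ ?_ ?_
  · rintro ⟨a, b⟩ ha
    simp only [mem_filter, mem_univ, true_and] at ha ⊢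
    obtain ⟨rfl, ha⟩ := ha
    exact ha
  · intro T hT
    simpa using hT
  · rintro ⟨a, b⟩ ha
    simp only [mem_filter, mem_univ, true_and] at ha
    simp [ha.1]
  · simp
  · rintro ⟨a, b⟩ ha
    simp only [mem_filter, mem_univ, true_and] at ha
    simp [ha.1]

lemma sum_fst_eq {ι : Type*} [Fintype ι] [DecidableEq ι] (T : ι) (Q : ι × ι → Prop)
    [DecidablePred Q] (f : ι → ι → ℝ) :
    ∑ a : ι × ι with a.2 = T ∧ Q a, f a.1 a.2 = ∑ S with Q (S, T), f S T := by
  refine sum_nbij' (fun a => a.1) (fun S => (S, T)) ?_ ?_ ?_ ?_ ?_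
  · rintro ⟨a, b⟩ ha
    simp only [mem_filter, mem_univ, true_and] at ha ⊢
    obtain ⟨rfl, ha⟩ := ha
    exact ha
  · intro S hS
    simpa using hS
  · rintro ⟨a, b⟩ ha
    simp only [mem_filter, mem_univ, true_and] at ha
    simp [ha.1]
  · simp
  · rintro ⟨a, b⟩ ha
    simp only [mem_filter, mem_univ, true_and] at ha
    simp [ha.1]

namespace InnerBoundLP

lemma w_nonneg' (h : InnerBoundLP P prec R x w) {k : Fin K}
    {a : Finset (Fin K) × Finset (Fin K)} (ha : a ∈ stages k) : 0 ≤ w k a.1 a.2 := by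
  rw [mem_stages] at ha
  exact h.w_nonneg k _ _ ha.1 (subset_univ_sdiff_singleton.2 ha.2)

/-- All stages together remove at least as many packets of status `S` as they and the initial supply
bring in. -/
lemma sum_drift_le (h : InnerBoundLP P prec R x w) {k : Fin K} {S : Finset (Fin K)} (hS : k ∉ S) :
    ∑ a ∈ stages k, w k a.1 a.2 * drift P S a ≤ if S = ∅ then -R k else 0 := by
  classical
  rw [sum_stages_drift P w S subset_rfl]
  have hdep : ∑ a ∈ stages k with a.1 = S, w k a.1 a.2 = ∑ T with T ⊆ S, w k S T := by
    rw [← sum_snd_eq S (fun a => a.2 ⊆ a.1) (w k)]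
    refine sum_congr ?_ fun _ _ => rfl
    ext a
    simp only [mem_filter, mem_stages, mem_univ, true_and]
    constructor
    · rintro ⟨⟨h1, -⟩, h2⟩
      exact ⟨h2, h1⟩
    · rintro ⟨rfl, h1⟩
      exact ⟨⟨h1, hS⟩, rfl⟩
  rw [hdep]
  split_ifs with h0
  · subst h0
    have h1 : ∑ a ∈ stages k with a.2 ⊆ ∅ ∧ ¬ ∅ ⊆ a.1,
        w k a.1 a.2 * P.fp (∅ \ a.2) (univ \ ∅) = 0 := by
      refine sum_eq_zero fun a ha => ?_
      simp at ha
    have h2 : ∑ T with T ⊆ (∅ : Finset (Fin K)), w k ∅ T = w k ∅ ∅ := by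
      have : ({T | T ⊆ ∅} : Finset (Finset (Fin K))) = {∅} := by
        ext T
        simp [subset_empty]
      rw [this, sum_singleton]
    have h3 := h.rate k
    rw [h1, h2, sdiff_empty]
    linarith
  · have h1 := h.clean_up k S (subset_univ_sdiff_singleton.2 hS) h0
    have h2 : ({a ∈ stages k | a.2 ⊆ S ∧ ¬ S ⊆ a.1}) =
        ({a | a.2 ⊆ a.1 ∧ a.1 ⊆ univ \ {k} ∧ a.2 ⊆ S ∧ ¬ S ⊆ a.1} :
          Finset (Finset (Fin K) × Finset (Fin K))) := by
      ext a
      simp only [mem_filter, mem_stages, mem_univ, true_and, subset_univ_sdiff_singleton]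
      tauto
    rw [h2]
    linarith

/-- The stages after a stage `(S, T)` remove at least as many packets of status `S` as they bring
in. -/
lemma sum_drift_after_le (h : InnerBoundLP P prec R x w)
    (hord : IsStrictTotalOrder (Finset (Fin K)) prec) (hcard : CardinalityCompatible prec)
    {k : Fin K} {b : Finset (Fin K) × Finset (Fin K)} (hb : b ∈ stages k) :
    ∑ a ∈ stagesAfter prec k b, w k a.1 a.2 * drift P b.1 a ≤ 0 := by
  classical
  obtain ⟨S, T⟩ := b
  obtain ⟨hTS, hkS⟩ := mem_stages.1 hb
  simp only at hTS hkS ⊢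
  by_cases hne : T = S
  · -- No packet gets status `S` any more once packets leave it in mixtures of `S ∪ {k}`.
    subst hne
    refine sum_nonpos fun a ha => mul_nonpos_of_nonneg_of_nonpos
      (h.w_nonneg' (mem_filter.1 ha).1) ?_
    obtain ⟨ha, hab⟩ := mem_filter.1 ha
    obtain ⟨ha1, ha2⟩ := mem_stages.1 ha
    have hU : 0 ≤ P.pUnion (univ \ T) := sum_nonneg fun _ _ => P.p_nonneg _
    rw [drift_eq P T ha1, if_neg]
    · split_ifs <;> simp [hU]
    · rintro ⟨h1, h2⟩
      rcases h1.eq_or_ssubset with h3 | h3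
      · exact h2 (h3 ▸ ha1)
      · refine hab (Or.inl (Or.inl (hcard _ _ ?_)))
        have hka : k ∉ a.2 := fun hk => ha2 (ha1 hk)
        rw [card_union_of_disjoint (disjoint_singleton_right.2 hka),
          card_union_of_disjoint (disjoint_singleton_right.2 hkS)]
        exact Nat.add_lt_add_right (card_lt_card h3) _
  · have hirr : ∀ U, ¬ prec U U := hord.toIsStrictOrder.toIrrefl.irrefl
    have hprecS : ∀ U, prec U S → ¬ S ⊆ U := by
      intro U hU hSU
      rcases hSU.eq_or_ssubset with h1 | h1
      · exact hirr S (h1 ▸ hU)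
      · exact hirr S (hord.toIsStrictOrder.toIsTrans.trans _ _ _ (hcard _ _ (card_lt_card h1)) hU)
    have hcons := h.conservation k S T hTS (subset_univ_sdiff_singleton.2 hkS) hne
    set pre : Finset (Finset (Fin K) × Finset (Fin K)) :=
      {a ∈ stages k | Before prec k a (S, T) ∨ a = (S, T)} with hpre
    have hmem : ∀ U V, (U, V) ∈ pre ↔ (V ⊆ U ∧ k ∉ U) ∧
        ((prec (V ∪ {k}) (T ∪ {k}) ∨ V = T ∧ prec U S) ∨ U = S ∧ V = T) := by
      intro U V
      rw [hpre, mem_filter, mem_stages, Before, Prod.mk.injEq]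
    have hsplit : ∑ a ∈ pre, w k a.1 a.2 * drift P S a +
        ∑ a ∈ stagesAfter prec k (S, T), w k a.1 a.2 * drift P S a =
        ∑ a ∈ stages k, w k a.1 a.2 * drift P S a :=
      sum_filter_add_sum_filter_not _ _ _
    have htot := h.sum_drift_le hkS
    have hS0 : S ≠ ∅ := by
      rintro rfl
      exact hne (subset_empty.1 hTS)
    rw [if_neg hS0, ← hsplit, sum_stages_drift P w (I := pre) S (filter_subset _ _)] at htot
    have hdep : ∑ a ∈ pre with a.1 = S, w k a.1 a.2 =
        w k S T + ∑ T₁ with T₁ ⊆ S ∧ prec (T₁ ∪ {k}) (T ∪ {k}), w k S T₁ := by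
      rw [← sum_insert (a := T) (by simp [hirr]) (f := fun T₁ => w k S T₁)]
      have h1 := sum_snd_eq S (fun a => a.2 = T ∨ a.2 ⊆ S ∧ prec (a.2 ∪ {k}) (T ∪ {k})) (w k)
      have h2 : (insert T ({T₁ | T₁ ⊆ S ∧ prec (T₁ ∪ {k}) (T ∪ {k})} : Finset (Finset (Fin K)))) =
          ({T₁ | T₁ = T ∨ T₁ ⊆ S ∧ prec (T₁ ∪ {k}) (T ∪ {k})} : Finset (Finset (Fin K))) := by
        ext U
        simp
      rw [h2, ← h1]
      refine sum_congr ?_ fun _ _ => rfl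
      ext ⟨U, V⟩
      simp only [mem_filter, hmem, mem_univ, true_and]
      constructor
      · rintro ⟨⟨⟨h3, -⟩, h4⟩, rfl⟩
        rcases h4 with (h4 | ⟨-, h4⟩) | ⟨-, h4⟩
        · exact ⟨rfl, Or.inr ⟨h3, h4⟩⟩
        · exact absurd h4 (hirr _)
        · exact ⟨rfl, Or.inl h4⟩
      · rintro ⟨rfl, rfl | ⟨h3, h4⟩⟩
        · exact ⟨⟨⟨hTS, hkS⟩, Or.inr ⟨rfl, rfl⟩⟩, rfl⟩
        · exact ⟨⟨⟨h3, hkS⟩, Or.inl (Or.inl h4)⟩, rfl⟩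
    have harr : ∑ a ∈ pre with a.2 ⊆ S ∧ ¬ S ⊆ a.1,
        w k a.1 a.2 * P.fp (S \ a.2) (univ \ S) =
        (∑ S₁ with prec S₁ S ∧ T ⊆ S₁ ∧ S₁ ⊆ univ \ {k},
          w k S₁ T * P.fp (S \ T) (univ \ S))
        + ∑ a : Finset (Fin K) × Finset (Fin K) with
          a.2 ⊆ a.1 ∧ a.1 ⊆ univ \ {k} ∧ prec (a.2 ∪ {k}) (T ∪ {k}) ∧ a.2 ⊆ S ∧ ¬ S ⊆ a.1,
        w k a.1 a.2 * P.fp (S \ a.2) (univ \ S) := by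
      have h1 := sum_fst_eq T (fun a => prec a.1 S ∧ T ⊆ a.1 ∧ a.1 ⊆ univ \ {k})
        (fun U V => w k U V * P.fp (S \ V) (univ \ S))
      rw [← h1, ← sum_union]
      · refine sum_congr ?_ fun _ _ => rfl
        ext ⟨U, V⟩
        simp only [mem_filter, hmem, mem_univ, true_and, mem_union,
          subset_univ_sdiff_singleton]
        constructor
        · rintro ⟨⟨⟨h3, h4⟩, h5⟩, h6, h7⟩
          rcases h5 with (h5 | ⟨rfl, h5⟩) | ⟨rfl, -⟩
          · exact Or.inr ⟨h3, h4, h5, h6, h7⟩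
          · exact Or.inl ⟨rfl, h5, h3, h4⟩
          · exact absurd subset_rfl h7
        · rintro (⟨rfl, h5, h3, h4⟩ | ⟨h3, h4, h5, h6, h7⟩)
          · exact ⟨⟨⟨h3, h4⟩, Or.inl (Or.inr ⟨rfl, h5⟩)⟩, hTS, hprecS _ h5⟩
          · exact ⟨⟨⟨h3, h4⟩, Or.inl (Or.inl h5)⟩, h6, h7⟩
      · rw [disjoint_left]
        rintro ⟨U, V⟩ h3 h4
        simp only [mem_filter, mem_univ, true_and] at h3 h4
        exact hirr _ (h3.1 ▸ h4.2.2.1)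
    rw [hdep, harr] at htot
    linarith

/-- The flow of packets out of the system, found by adding up the balances of all statuses, bounds
the rate. So a receiver with a positive rate is
reached with positive probability. -/
lemma rate_le (h : InnerBoundLP P prec R x w) (k : Fin K) :
    R k ≤ P.pUnion {k} * ∑ a ∈ stages k, w k a.1 a.2 := by
  classical
  have h1 : ∑ S with k ∉ S, ∑ a ∈ stages k, w k a.1 a.2 * drift P S a ≤
      ∑ S with k ∉ S, if S = ∅ then -R k else 0 :=
    sum_le_sum fun S hS => h.sum_drift_le (by simpa using hS)
  have h2 : ∑ S : Finset (Fin K) with k ∉ S, (if S = ∅ then -R k else 0) = -R k := by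
    rw [sum_ite_eq' _ ∅, if_pos (by simp)]
  rw [h2, sum_comm] at h1
  simp_rw [← mul_sum] at h1
  have h3 : ∀ a ∈ stages k, ∑ S with k ∉ S, drift P S a = -P.pUnion {k} := by
    intro a ha
    obtain ⟨ha1, ha2⟩ := mem_stages.1 ha
    unfold drift BroadcastPEC.pUnion
    rw [sum_comm, sum_filter, ← sum_neg_distrib]
    refine sum_congr rfl fun A _ => ?_
    have h4 : ∑ S with k ∉ S, gain S a A = if k ∈ A then -1 else 0 := by
      unfold gain
      have hka : k ∉ a.2 := fun hk => ha2 (ha1 hk)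
      have h5 : ∀ S : Finset (Fin K), (if a.1 = S ∧ ¬ A ⊆ S then (1 : ℝ) else 0) =
          if a.1 = S then (if ¬ A ⊆ a.1 then 1 else 0) else 0 := by
        intro S
        split_ifs <;> simp_all
      have h6 : ∀ S : Finset (Fin K), (if ¬ A ⊆ a.1 ∧ a.2 ∪ A = S then (1 : ℝ) else 0) =
          if a.2 ∪ A = S then (if ¬ A ⊆ a.1 then 1 else 0) else 0 := by
        intro S
        split_ifs <;> simp_all
      simp_rw [h5, h6, sum_sub_distrib, sum_ite_eq]
      by_cases hkA : k ∈ A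
      · have hA : ¬ A ⊆ a.1 := fun h => ha2 (h hkA)
        simp [hkA, ha2, hA]
      · simp [hkA, ha2, hka]
    have h7 : (A ∩ {k}).Nonempty ↔ k ∈ A := by
      simp [Finset.Nonempty]
    simp_rw [← mul_sum, h4, h7]
    split_ifs <;> simp
  rw [sum_congr rfl fun a ha => by rw [h3 a ha]] at h1
  rw [← sum_mul] at h1
  linarith

end InnerBoundLP
end Balance

/-! ### The timeline of the scheme -/

section Timeline

open Classical in
/-- Blocks of lengths `ℓ i` are placed one after the other in the order `r`: the start of block
`i`. -/
def blockStart {ι : Type*} [Fintype ι] (r : ι → ι → Prop) (ℓ : ι → ℝ) (i : ι) : ℝ :=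
  ∑ j with r j i, ℓ j

section

variable {ι : Type*} [Fintype ι] {r : ι → ι → Prop} {ℓ : ι → ℝ}

lemma blockStart_nonneg (hℓ : ∀ i, 0 ≤ ℓ i) (i : ι) : 0 ≤ blockStart r ℓ i :=
  sum_nonneg fun j _ => hℓ j

open Classical in
lemma blockStart_add (hr : ∀ i, ¬ r i i) (i : ι) :
    blockStart r ℓ i + ℓ i = ∑ j with r j i ∨ j = i, ℓ j := by
  classical
  have h : ({j | r j i ∨ j = i} : Finset ι) = insert i ({j | r j i} : Finset ι) := by
    ext j
    simp [or_comm]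
  rw [h, sum_insert (by simp [hr]), add_comm, blockStart]

lemma blockStart_add_le_sum (hr : ∀ i, ¬ r i i) (hℓ : ∀ i, 0 ≤ ℓ i) (i : ι) :
    blockStart r ℓ i + ℓ i ≤ ∑ j, ℓ j := by
  classical
  rw [blockStart_add hr]
  exact sum_le_sum_of_subset_of_nonneg (subset_univ _) fun j _ _ => hℓ j

lemma blockStart_add_le (hr : ∀ i, ¬ r i i) (ht : ∀ i j l, r i j → r j l → r i l)
    (hℓ : ∀ i, 0 ≤ ℓ i) {i j : ι} (hij : r i j) :
    blockStart r ℓ i + ℓ i ≤ blockStart r ℓ j := by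
  classical
  rw [blockStart_add hr, blockStart]
  refine sum_le_sum_of_subset_of_nonneg (fun l hl => ?_) fun j _ _ => hℓ j
  simp only [mem_filter, mem_univ, true_and] at hl ⊢
  rcases hl with hl | rfl
  exacts [ht _ _ _ hl hij, hij]

end

/-- Slot `t` of `n` belongs to the block that takes the fraction `[α, α + ℓ)` of the time. -/
def InBlock (n : ℕ) (α ℓ : ℝ) (t : ℕ) : Prop := (n : ℝ) * α ≤ t ∧ (t : ℝ) < n * (α + ℓ)

lemma InBlock.lt_of_le {n : ℕ} {α ℓ α' ℓ' : ℝ} {t t' : ℕ} (h : InBlock n α ℓ t)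
    (h' : InBlock n α' ℓ' t') (hle : α + ℓ ≤ α') : t < t' := by
  have h1 := mul_le_mul_of_nonneg_left hle (Nat.cast_nonneg (α := ℝ) n)
  have h2 : (t : ℝ) < t' := h.2.trans_le (h1.trans h'.1)
  exact_mod_cast h2

lemma InBlock.mono {n : ℕ} {α ℓ α' ℓ' : ℝ} {t : ℕ} (h : InBlock n α ℓ t) (h1 : α' ≤ α)
    (h2 : α + ℓ ≤ α' + ℓ') : InBlock n α' ℓ' t :=
  ⟨(mul_le_mul_of_nonneg_left h1 (Nat.cast_nonneg n)).trans h.1,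
    h.2.trans_le (mul_le_mul_of_nonneg_left h2 (Nat.cast_nonneg n))⟩

open Classical in
lemma abs_card_inBlock_sub_le {n : ℕ} {α ℓ : ℝ} (hα : 0 ≤ α) (hℓ : 0 ≤ ℓ) (h1 : α + ℓ ≤ 1) :
    |(#{t ∈ range n | InBlock n α ℓ t} : ℝ) - n * ℓ| ≤ 1 := by
  have hn : (0 : ℝ) ≤ n := Nat.cast_nonneg n
  have h0 : 0 ≤ (n : ℝ) * α := mul_nonneg hn hα
  have hle : (n : ℝ) * α ≤ n * (α + ℓ) := mul_le_mul_of_nonneg_left (by linarith) hn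
  have hset : {t ∈ range n | InBlock n α ℓ t} = Ico ⌈(n : ℝ) * α⌉₊ ⌈(n : ℝ) * (α + ℓ)⌉₊ := by
    ext t
    rw [mem_filter, mem_range, mem_Ico, Nat.ceil_le, Nat.lt_ceil]
    constructor
    · exact fun h => h.2
    · refine fun h => ⟨?_, h⟩
      have h2 : (t : ℝ) < n := h.2.trans_le (mul_le_of_le_one_right hn h1)
      exact_mod_cast h2
  rw [hset, Nat.card_Ico, Nat.cast_sub (Nat.ceil_mono hle), abs_le]
  have h3 := Nat.ceil_lt_add_one h0
  have h4 := Nat.le_ceil ((n : ℝ) * α)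
  have h5 := Nat.ceil_lt_add_one (h0.trans hle)
  have h6 := Nat.le_ceil ((n : ℝ) * (α + ℓ))
  constructor <;> linarith

variable {K : ℕ} {prec : Finset (Fin K) → Finset (Fin K) → Prop}
  {x : Finset (Fin K) → ℝ} {w : Fin K → Finset (Fin K) → Finset (Fin K) → ℝ}

open Classical in
/-- The lengths of the stages of session `k` in which the sessions `T ∪ {k}` are mixed. -/
def stageLength (w : Fin K → Finset (Fin K) → Finset (Fin K) → ℝ) (k : Fin K)
    (T S : Finset (Fin K)) : ℝ := if (S, T) ∈ stages k then w k S T else 0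

/-- The start of a stage of session `k`: the stages that mix the same sessions share one phase,
whose length is given by `x`. -/
def stageStart (prec : Finset (Fin K) → Finset (Fin K) → Prop) (x : Finset (Fin K) → ℝ)
    (w : Fin K → Finset (Fin K) → Finset (Fin K) → ℝ) (k : Fin K)
    (a : Finset (Fin K) × Finset (Fin K)) : ℝ :=
  blockStart prec x (a.2 ∪ {k}) + blockStart prec (stageLength w k a.2) a.1

/-- Slot `t` belongs to stage `a` of session `k`. -/
def InStage (prec : Finset (Fin K) → Finset (Fin K) → Prop) (x : Finset (Fin K) → ℝ)
    (w : Fin K → Finset (Fin K) → Finset (Fin K) → ℝ) (n : ℕ) (k : Fin K)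
    (a : Finset (Fin K) × Finset (Fin K)) (t : ℕ) : Prop :=
  InBlock n (stageStart prec x w k a) (w k a.1 a.2) t

/-- Slot `t` belongs to the block after all phases that is reserved for the unfinished packets of
session `k`. -/
def InCleanUp (x : Finset (Fin K) → ℝ) (η : ℝ) (n : ℕ) (k : Fin K) (t : ℕ) : Prop :=
  InBlock n (∑ S, x S + (k : ℕ) * η) η t


lemma union_singleton_sdiff {k : Fin K} {T : Finset (Fin K)} (hk : k ∉ T) :
    (T ∪ {k}) \ {k} = T := by
  rw [union_sdiff_right, sdiff_eq_self_of_disjoint (disjoint_singleton_right.2 hk)]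

variable {P : BroadcastPEC K} {R : Fin K → ℝ}

namespace InnerBoundLP

lemma stageLength_nonneg (h : InnerBoundLP P prec R x w) (k : Fin K) (T S : Finset (Fin K)) :
    0 ≤ stageLength w k T S := by
  unfold stageLength
  split_ifs with ha
  exacts [h.w_nonneg' ha, le_rfl]

lemma stageStart_nonneg (h : InnerBoundLP P prec R x w) (k : Fin K)
    (a : Finset (Fin K) × Finset (Fin K)) : 0 ≤ stageStart prec x w k a :=
  add_nonneg (blockStart_nonneg h.x_nonneg _) (blockStart_nonneg (h.stageLength_nonneg k _) _)

/-- The stages of a phase fit into it. -/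
lemma stageStart_add_le_phase (h : InnerBoundLP P prec R x w) (hirr : ∀ S, ¬ prec S S) {k : Fin K}
    {a : Finset (Fin K) × Finset (Fin K)} (ha : a ∈ stages k) :
    stageStart prec x w k a + w k a.1 a.2 ≤
      blockStart prec x (a.2 ∪ {k}) + x (a.2 ∪ {k}) := by
  classical
  obtain ⟨ha1, ha2⟩ := mem_stages.1 ha
  have hka : k ∉ a.2 := fun hk => ha2 (ha1 hk)
  have h1 := blockStart_add_le_sum (ℓ := stageLength w k a.2) hirr (h.stageLength_nonneg k a.2) a.1
  have h2 := h.coding_length (a.2 ∪ {k}) k (by simp)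
  rw [union_singleton_sdiff hka] at h2
  have h4 : ∑ S, stageLength w k a.2 S = ∑ S with a.2 ⊆ S ∧ S ⊆ univ \ {k}, w k S a.2 := by
    unfold stageLength
    rw [← sum_filter]
    refine sum_congr ?_ fun _ _ => rfl
    ext S
    simp only [mem_filter, mem_univ, true_and, mem_stages, subset_univ_sdiff_singleton]
  have h5 : stageLength w k a.2 a.1 = w k a.1 a.2 := if_pos ha
  unfold stageStart
  linarith

lemma stageStart_add_le_sum (h : InnerBoundLP P prec R x w) (hirr : ∀ S, ¬ prec S S) {k : Fin K}
    {a : Finset (Fin K) × Finset (Fin K)} (ha : a ∈ stages k) :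
    stageStart prec x w k a + w k a.1 a.2 ≤ ∑ S, x S :=
  (h.stageStart_add_le_phase hirr ha).trans (blockStart_add_le_sum hirr h.x_nonneg _)

lemma stageStart_add_le_of_before (h : InnerBoundLP P prec R x w) (hirr : ∀ S, ¬ prec S S)
    (htr : ∀ S T U, prec S T → prec T U → prec S U) {k : Fin K}
    {a b : Finset (Fin K) × Finset (Fin K)} (ha : a ∈ stages k) (hab : Before prec k a b) :
    stageStart prec x w k a + w k a.1 a.2 ≤ stageStart prec x w k b := by
  rcases hab with hab | ⟨h1, h2⟩
  · refine (h.stageStart_add_le_phase hirr ha).trans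
      ((blockStart_add_le hirr htr h.x_nonneg hab).trans ?_)
    exact le_add_of_nonneg_right (blockStart_nonneg (h.stageLength_nonneg k _) _)
  · have h5 : stageLength w k a.2 a.1 = w k a.1 a.2 := if_pos ha
    have h6 := blockStart_add_le hirr htr (h.stageLength_nonneg k a.2) h2
    unfold stageStart
    rw [← h1]
    linarith

lemma before_or_after (hord : IsStrictTotalOrder (Finset (Fin K)) prec) {k : Fin K}
    {a b : Finset (Fin K) × Finset (Fin K)} (ha : a ∈ stages k) (hb : b ∈ stages k) :
    Before prec k a b ∨ a = b ∨ Before prec k b a := by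
  obtain ⟨ha1, ha2⟩ := mem_stages.1 ha
  obtain ⟨hb1, hb2⟩ := mem_stages.1 hb
  rcases trichotomous_of prec (a.2 ∪ {k}) (b.2 ∪ {k}) with h1 | h1 | h1
  · exact Or.inl (Or.inl h1)
  · have h2 : a.2 = b.2 := by
      have h3 := congrArg (· \ {k}) h1
      rwa [union_singleton_sdiff fun hk => ha2 (ha1 hk),
        union_singleton_sdiff fun hk => hb2 (hb1 hk)] at h3
    rcases trichotomous_of prec a.1 b.1 with h3 | h3 | h3
    · exact Or.inl (Or.inr ⟨h2, h3⟩)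
    · exact Or.inr (Or.inl (Prod.ext h3 h2))
    · exact Or.inr (Or.inr (Or.inr ⟨h2.symm, h3⟩))
  · exact Or.inr (Or.inr (Or.inl h1))

lemma inStage_unique (h : InnerBoundLP P prec R x w)
    (hord : IsStrictTotalOrder (Finset (Fin K)) prec) {n : ℕ} {k : Fin K}
    {a b : Finset (Fin K) × Finset (Fin K)} (ha : a ∈ stages k) (hb : b ∈ stages k) {t : ℕ}
    (hat : InStage prec x w n k a t) (hbt : InStage prec x w n k b t) : a = b := by
  rcases before_or_after hord ha hb with h1 | h1 | h1
  · exact absurd (hat.lt_of_le hbt (h.stageStart_add_le_of_before (fun S => irrefl_of prec S)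
      (fun _ _ _ => trans_of prec) ha h1)) (lt_irrefl t)
  · exact h1
  · exact absurd (hbt.lt_of_le hat (h.stageStart_add_le_of_before (fun S => irrefl_of prec S)
      (fun _ _ _ => trans_of prec) hb h1)) (lt_irrefl t)

end InnerBoundLP

open Classical in
/-- The sessions that are mixed in slot `t`. -/
def mixedSessions (prec : Finset (Fin K) → Finset (Fin K) → Prop) (x : Finset (Fin K) → ℝ)
    (η : ℝ) (n t : ℕ) : Finset (Fin K) :=
  {i | (∃ T, i ∈ T ∧ InBlock n (blockStart prec x T) (x T) t) ∨ InCleanUp x η n i t}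

/-- A packet of session `k` with status `S` may be sent in slot `t`, either because a stage of the
linear program says so, or in the clean-up block of the session. -/
def Eligible (prec : Finset (Fin K) → Finset (Fin K) → Prop) (x : Finset (Fin K) → ℝ)
    (w : Fin K → Finset (Fin K) → Finset (Fin K) → ℝ) (η : ℝ) (n t : ℕ) (k : Fin K)
    (S : Finset (Fin K)) : Prop :=
  (∃ T, (S, T) ∈ stages k ∧ InStage prec x w n k (S, T) t) ∨ (k ∉ S ∧ InCleanUp x η n k t)

namespace InnerBoundLP

lemma mixedSessions_of_inStage (h : InnerBoundLP P prec R x w)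
    (hord : IsStrictTotalOrder (Finset (Fin K)) prec) {η : ℝ} (hη : 0 ≤ η) {n t : ℕ} {k : Fin K}
    {a : Finset (Fin K) × Finset (Fin K)} (ha : a ∈ stages k) (hat : InStage prec x w n k a t) :
    mixedSessions prec x η n t = a.2 ∪ {k} := by
  have hirr : ∀ S, ¬ prec S S := fun S => irrefl_of prec S
  have htr : ∀ S T U, prec S T → prec T U → prec S U := fun _ _ _ => trans_of prec
  have hphase : InBlock n (blockStart prec x (a.2 ∪ {k})) (x (a.2 ∪ {k})) t :=
    hat.mono (le_add_of_nonneg_right (blockStart_nonneg (h.stageLength_nonneg k _) _))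
      (h.stageStart_add_le_phase hirr ha)
  have huniq : ∀ T, InBlock n (blockStart prec x T) (x T) t → T = a.2 ∪ {k} := by
    intro T hT
    rcases trichotomous_of prec T (a.2 ∪ {k}) with h1 | h1 | h1
    · exact absurd (hT.lt_of_le hphase (blockStart_add_le hirr htr h.x_nonneg h1)) (lt_irrefl t)
    · exact h1
    · exact absurd (hphase.lt_of_le hT (blockStart_add_le hirr htr h.x_nonneg h1)) (lt_irrefl t)
  ext i
  simp only [mixedSessions, mem_filter, mem_univ, true_and]
  constructor
  · rintro (⟨T, hi, hT⟩ | hi)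
    · exact huniq T hT ▸ hi
    · refine absurd (hat.lt_of_le hi ?_) (lt_irrefl t)
      exact (h.stageStart_add_le_sum hirr ha).trans (le_add_of_nonneg_right (by positivity))
  · exact fun hi => Or.inl ⟨_, hi, hphase⟩

lemma mixedSessions_of_inCleanUp (h : InnerBoundLP P prec R x w)
    (hord : IsStrictTotalOrder (Finset (Fin K)) prec) {η : ℝ} (hη : 0 ≤ η) {n t : ℕ} {k : Fin K}
    (hk : InCleanUp x η n k t) : mixedSessions prec x η n t = {k} := by
  have hirr : ∀ S, ¬ prec S S := fun S => irrefl_of prec S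
  have hlt : ∀ i j : Fin K, i < j → InCleanUp x η n i t → ¬ InCleanUp x η n j t := by
    intro i j hij hi hj
    refine absurd (hi.lt_of_le hj ?_) (lt_irrefl t)
    have h1 : ((i : ℕ) : ℝ) + 1 ≤ (j : ℕ) := by exact_mod_cast hij
    have h2 := mul_le_mul_of_nonneg_right h1 hη
    linarith
  ext i
  simp only [mixedSessions, mem_filter, mem_univ, true_and, mem_singleton]
  constructor
  · rintro (⟨T, hi, hT⟩ | hi)
    · refine absurd (hT.lt_of_le hk ?_) (lt_irrefl t)
      exact (blockStart_add_le_sum hirr h.x_nonneg T).trans (le_add_of_nonneg_right (by positivity))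
    · rcases lt_trichotomy i k with h1 | h1 | h1
      · exact absurd hk (hlt i k h1 hi)
      · exact h1
      · exact absurd hi (hlt k i h1 hk)
  · rintro rfl
    exact Or.inr hk

/-- The schedule that follows the linear program and then cleans up. -/
def schedule (h : InnerBoundLP P prec R x w) (hord : IsStrictTotalOrder (Finset (Fin K)) prec)
    {η : ℝ} (hη : 0 ≤ η) (n : ℕ) : Schedule K where
  mix := mixedSessions prec x η n
  elig := Eligible prec x w η n
  valid t k S hS := by
    rcases hS with ⟨T, hT, hS⟩ | ⟨hkS, hS⟩
    · obtain ⟨hTS, hkS⟩ := mem_stages.1 hT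
      rw [h.mixedSessions_of_inStage hord hη hT hS]
      exact ⟨by simp, by rw [union_sdiff_right]; exact sdiff_subset.trans hTS, hkS⟩
    · rw [h.mixedSessions_of_inCleanUp hord hη hS]
      simp [hkS]

end InnerBoundLP
end Timeline

/-! ### Queues under the schedule -/

section Queues

variable {K : ℕ} {prec : Finset (Fin K) → Finset (Fin K) → Prop}
  {x : Finset (Fin K) → ℝ} {w : Fin K → Finset (Fin K) → Finset (Fin K) → ℝ}
  {P : BroadcastPEC K} {R : Fin K → ℝ}

open Classical in
/-- The net number of packets that gain status `S` in slot `t` if the set `A` is reached, when only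
the stages in `I` are counted and no slot is idle. -/
def netInput (prec : Finset (Fin K) → Finset (Fin K) → Prop) (x : Finset (Fin K) → ℝ)
    (w : Fin K → Finset (Fin K) → Finset (Fin K) → ℝ) (n : ℕ) (k : Fin K)
    (I : Finset (Finset (Fin K) × Finset (Fin K))) (S : Finset (Fin K)) (t : ℕ)
    (A : Finset (Fin K)) : ℝ :=
  ∑ a ∈ I, if InStage prec x w n k a t then gain S a A else 0

namespace InnerBoundLP

lemma inStage_lt_ceil (h : InnerBoundLP P prec R x w)
    (hord : IsStrictTotalOrder (Finset (Fin K)) prec) {n t : ℕ} {k : Fin K}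
    {a : Finset (Fin K) × Finset (Fin K)} (ha : a ∈ stages k) (hat : InStage prec x w n k a t) :
    t < ⌈(n : ℝ) * ∑ S, x S⌉₊ := by
  rw [Nat.lt_ceil]
  exact hat.2.trans_le (mul_le_mul_of_nonneg_left
    (h.stageStart_add_le_sum (fun S => irrefl_of prec S) ha) (Nat.cast_nonneg n))

lemma not_inCleanUp_of_lt {η : ℝ} (hη : 0 ≤ η) {n t : ℕ} {k : Fin K}
    (ht : t < ⌈(n : ℝ) * ∑ S, x S⌉₊) : ¬ InCleanUp x η n k t := by
  rw [Nat.lt_ceil] at ht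
  intro hc
  have h1 : (n : ℝ) * ∑ S, x S ≤ n * (∑ S, x S + (k : ℕ) * η) :=
    mul_le_mul_of_nonneg_left (le_add_of_nonneg_right (by positivity)) (Nat.cast_nonneg n)
  exact absurd (ht.trans_le (h1.trans hc.1)) (lt_irrefl _)

lemma eligible_iff_of_lt {η : ℝ} (hη : 0 ≤ η) {n t : ℕ} {k : Fin K} {S : Finset (Fin K)}
    (ht : t < ⌈(n : ℝ) * ∑ S, x S⌉₊) : Eligible prec x w η n t k S ↔
      ∃ T, (S, T) ∈ stages k ∧ InStage prec x w n k (S, T) t :=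
  ⟨fun hS => hS.resolve_right fun hc => not_inCleanUp_of_lt hη ht hc.2, Or.inl⟩

lemma arrival_sub_departure (h : InnerBoundLP P prec R x w)
    (hord : IsStrictTotalOrder (Finset (Fin K)) prec) {η : ℝ} (hη : 0 ≤ η) {n t : ℕ} {k : Fin K}
    (ht : t < ⌈(n : ℝ) * ∑ S, x S⌉₊) (s : ℕ → Finset (Fin K)) (S : Finset (Fin K)) :
    (((h.schedule hord hη n).arrival s k S t : ℝ) - (h.schedule hord hη n).departure s k S t) =
      netInput prec x w n k (stages k) S t (s t) := by
  classical
  by_cases hex : ∃ a ∈ stages k, InStage prec x w n k a t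
  · obtain ⟨a, ha, hat⟩ := hex
    obtain ⟨ha1, ha2⟩ := mem_stages.1 ha
    have hel : ∀ S', (h.schedule hord hη n).elig t k S' ↔ S' = a.1 := by
      intro S'
      refine (eligible_iff_of_lt hη ht).trans ⟨?_, ?_⟩
      · rintro ⟨T, hT, hST⟩
        exact congrArg Prod.fst (h.inStage_unique hord hT ha hST hat)
      · rintro rfl
        exact ⟨a.2, ha, hat⟩
    have hmix : (h.schedule hord hη n).mix t \ {k} = a.2 := by
      rw [← union_singleton_sdiff (k := k) (T := a.2) fun hk => ha2 (ha1 hk)]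
      exact congrArg (· \ {k}) (h.mixedSessions_of_inStage hord hη ha hat)
    have hnet : netInput prec x w n k (stages k) S t (s t) = gain S a (s t) := by
      rw [netInput, sum_eq_single_of_mem a ha, if_pos hat]
      intro b hb hba
      exact if_neg fun hbt => hba (h.inStage_unique hord hb ha hbt hat)
    rw [hnet]
    unfold Schedule.arrival Schedule.departure gain
    have h1 : (∃ S₁, (h.schedule hord hη n).elig t k S₁ ∧ ¬ s t ⊆ S₁ ∧
        (h.schedule hord hη n).mix t \ {k} ∪ s t = S) ↔ ¬ s t ⊆ a.1 ∧ a.2 ∪ s t = S := by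
      simp only [hel, hmix, exists_eq_left]
    have h2 : ((h.schedule hord hη n).elig t k S ∧ ¬ s t ⊆ S) ↔ (a.1 = S ∧ ¬ s t ⊆ S) := by
      rw [hel, eq_comm]
    simp only [h1, h2]
    push_cast
    rfl
  · have hel : ∀ S', ¬ (h.schedule hord hη n).elig t k S' := by
      intro S' hS'
      obtain ⟨T, hT, hST⟩ := (eligible_iff_of_lt hη ht).1 hS'
      exact hex ⟨_, hT, hST⟩
    have hnet : netInput prec x w n k (stages k) S t (s t) = 0 :=
      sum_eq_zero fun a ha => if_neg fun hat => hex ⟨a, ha, hat⟩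
    rw [hnet, Schedule.arrival, Schedule.departure, if_neg, if_neg]
    · simp
    · exact fun hS => hel _ hS.1
    · exact fun ⟨_, hS, _⟩ => hel _ hS

lemma netInput_eq_zero (h : InnerBoundLP P prec R x w)
    (hord : IsStrictTotalOrder (Finset (Fin K)) prec) {n t : ℕ} {k : Fin K}
    (ht : ⌈(n : ℝ) * ∑ S, x S⌉₊ ≤ t) (S A : Finset (Fin K)) :
    netInput prec x w n k (stages k) S t A = 0 :=
  sum_eq_zero fun _ ha => if_neg fun hat => (h.inStage_lt_ceil hord ha hat).not_ge ht

/-- After a slot of stage `b`, the input of all stages is at most that of the stages after `b`. -/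
lemma sum_netInput_le_after (h : InnerBoundLP P prec R x w)
    (hord : IsStrictTotalOrder (Finset (Fin K)) prec) {n τ N : ℕ} {k : Fin K}
    {b : Finset (Fin K) × Finset (Fin K)} (hb : b ∈ stages k) (hbτ : InStage prec x w n k b τ)
    (s : ℕ → Finset (Fin K)) :
    ∑ t ∈ Ico (τ + 1) N, netInput prec x w n k (stages k) b.1 t (s t) ≤
      ∑ t ∈ range N, netInput prec x w n k (stagesAfter prec k b) b.1 t (s t) := by
  classical
  have hirr : ∀ S, ¬ prec S S := fun S => irrefl_of prec S
  have htr : ∀ S T U, prec S T → prec T U → prec S U := fun _ _ _ => trans_of prec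
  have hlater : ∀ a ∈ stagesAfter prec k b, ∀ t, InStage prec x w n k a t → τ < t := by
    intro a ha t hat
    obtain ⟨ha, hab⟩ := mem_filter.1 ha
    rcases before_or_after hord ha hb with h1 | h1 | h1
    · exact absurd (Or.inl h1) hab
    · exact absurd (Or.inr h1) hab
    · exact hbτ.lt_of_le hat (h.stageStart_add_le_of_before hirr htr hb h1)
  have hsub : ∑ t ∈ Ico (τ + 1) N, netInput prec x w n k (stagesAfter prec k b) b.1 t (s t) =
      ∑ t ∈ range N, netInput prec x w n k (stagesAfter prec k b) b.1 t (s t) := by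
    refine sum_subset (fun t ht => by simp at ht ⊢; omega) fun t ht ht' => ?_
    refine sum_eq_zero fun a ha => if_neg fun hat => ht' ?_
    have := hlater a ha t hat
    simp at ht ⊢
    omega
  rw [← hsub]
  refine sum_le_sum fun t ht => ?_
  have htτ : τ < t := by simp at ht; omega
  have hsplit : netInput prec x w n k (stages k) b.1 t (s t) =
      ∑ a ∈ stages k with Before prec k a b ∨ a = b,
        (if InStage prec x w n k a t then gain b.1 a (s t) else 0) +
      netInput prec x w n k (stagesAfter prec k b) b.1 t (s t) :=
    (sum_filter_add_sum_filter_not _ _ _).symm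
  rw [hsplit]
  refine add_le_of_nonpos_left (sum_nonpos fun a ha => ?_)
  split_ifs with hat
  · obtain ⟨ha, hab | rfl⟩ := mem_filter.1 ha
    · exact absurd (hat.lt_of_le hbτ (h.stageStart_add_le_of_before hirr htr ha hab)) (by omega)
    · -- A packet that leaves status `S` in its own stage does not return to `S`.
      unfold gain
      rw [if_neg]
      · split_ifs <;> norm_num
      · rintro ⟨h1, h2⟩
        exact h1 (subset_union_right.trans h2.subset)
  · exact le_rfl

/-- If the inputs of all stages together, and of the stages after each stage that serves `S`, do not
exceed `B`, then neither does the queue of packets with status `S` when the phases are over. -/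
lemma queue_le (h : InnerBoundLP P prec R x w)
    (hord : IsStrictTotalOrder (Finset (Fin K)) prec) {η : ℝ} (hη : 0 ≤ η) {n m : ℕ} {k : Fin K}
    (hx : ∑ S, x S ≤ 1) (s : ℕ → Finset (Fin K)) (S : Finset (Fin K)) {B : ℝ}
    (htot : (if S = ∅ then (m : ℝ) else 0) +
      ∑ t ∈ range n, netInput prec x w n k (stages k) S t (s t) ≤ B)
    (hafter : ∀ T, (S, T) ∈ stages k →
      ∑ t ∈ range n, netInput prec x w n k (stagesAfter prec k (S, T)) S t (s t) ≤ B) :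
    ((h.schedule hord hη n).queue m s k S ⌈(n : ℝ) * ∑ S, x S⌉₊ : ℝ) ≤ B := by
  classical
  set D := h.schedule hord hη n with hD
  set t₀ := ⌈(n : ℝ) * ∑ S, x S⌉₊ with ht₀
  have ht₀n : t₀ ≤ n := by
    rw [ht₀, Nat.ceil_le]
    exact mul_le_of_le_one_right (Nat.cast_nonneg n) hx
  have huniq : ∀ t < t₀, ∀ S₁ S₂, D.elig t k S₁ → D.elig t k S₂ → S₁ = S₂ := by
    intro t ht S₁ S₂ h1 h2
    obtain ⟨T₁, hT₁, h1⟩ := (eligible_iff_of_lt hη ht).1 h1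
    obtain ⟨T₂, hT₂, h2⟩ := (eligible_iff_of_lt hη ht).1 h2
    exact congrArg Prod.fst (h.inStage_unique hord hT₁ hT₂ h1 h2)
  have hqueue := queue_le_net_input (r := D.queue m s k S) (a := D.arrival s k S)
    (d := D.departure s k S) (T := t₀) (fun t ht => D.queue_succ_le m s S t (huniq t ht))
    (fun t => by unfold Schedule.departure; split_ifs <;> simp)
    (fun t ht => by
      unfold Schedule.departure at ht
      split_ifs at ht with hd
      refine if_neg ?_
      rintro ⟨S₁, -, -, h1⟩
      exact hd.2 (h1 ▸ subset_union_right))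
  have hcast : ∀ I : Finset ℕ, (∀ t ∈ I, t < t₀) →
      ((∑ t ∈ I, ((D.arrival s k S t : ℤ) - D.departure s k S t) : ℤ) : ℝ) =
        ∑ t ∈ I, netInput prec x w n k (stages k) S t (s t) := by
    intro I hI
    push_cast
    exact sum_congr rfl fun t ht => h.arrival_sub_departure hord hη (hI t ht) s S
  have hrange : ∑ t ∈ range t₀, netInput prec x w n k (stages k) S t (s t) =
      ∑ t ∈ range n, netInput prec x w n k (stages k) S t (s t) := by
    refine sum_subset (range_subset_range.2 ht₀n) fun t _ ht => h.netInput_eq_zero hord ?_ S _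
    exact not_lt.1 fun h' => ht (mem_range.2 h')
  rcases hqueue with h1 | ⟨τ, hτ, hd, h1⟩
  · have h2 : D.queue m s k S 0 = if S = ∅ then m else 0 := by
      unfold Schedule.queue
      by_cases hS : S = ∅
      · simp [Schedule.status, hS]
      · simp [Schedule.status, hS, eq_comm]
    have h3 : (D.queue m s k S t₀ : ℝ) ≤ D.queue m s k S 0 +
        ((∑ t ∈ range t₀, ((D.arrival s k S t : ℤ) - D.departure s k S t) : ℤ) : ℝ) := by
      exact_mod_cast h1
    rw [hcast _ (by simp), hrange, h2] at h3
    push_cast at h3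
    exact h3.trans htot
  · unfold Schedule.departure at hd
    split_ifs at hd with hd'
    obtain ⟨T, hT, hTτ⟩ := (eligible_iff_of_lt hη hτ).1 hd'.1
    have h3 : (D.queue m s k S t₀ : ℝ) ≤
        ((∑ t ∈ Ico (τ + 1) t₀, ((D.arrival s k S t : ℤ) - D.departure s k S t) : ℤ) : ℝ) := by
      exact_mod_cast h1
    rw [hcast _ (by simp)] at h3
    refine h3.trans (le_trans ?_ (hafter T hT))
    have h4 : ∑ t ∈ Ico (τ + 1) t₀, netInput prec x w n k (stages k) S t (s t) =
        ∑ t ∈ Ico (τ + 1) n, netInput prec x w n k (stages k) S t (s t) := by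
      refine sum_subset (Ico_subset_Ico_right ht₀n) fun t ht ht' =>
        h.netInput_eq_zero hord ?_ S _
      simp at ht ht'
      exact ht' ht.1
    rw [h4]
    exact h.sum_netInput_le_after hord hT hTτ s

end InnerBoundLP
end Queues

/-! ### The probability of failure -/

section Failure

variable {K : ℕ} {prec : Finset (Fin K) → Finset (Fin K) → Prop}
  {x : Finset (Fin K) → ℝ} {w : Fin K → Finset (Fin K) → Finset (Fin K) → ℝ}
  {P : BroadcastPEC K} {R : Fin K → ℝ}

/-- The number of pairs of sets of receivers, a bound for the number of stages of a session. -/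
def pairCount (K : ℕ) : ℝ := Fintype.card (Finset (Fin K) × Finset (Fin K))

lemma one_le_pairCount (K : ℕ) : 1 ≤ pairCount K := by
  have : 0 < Fintype.card (Finset (Fin K) × Finset (Fin K)) := Fintype.card_pos
  unfold pairCount
  exact_mod_cast this

lemma card_le_pairCount (I : Finset (Finset (Fin K) × Finset (Fin K))) :
    (#I : ℝ) ≤ pairCount K := Nat.cast_le.2 (card_le_univ I)

lemma card_sets_le_pairCount (I : Finset (Finset (Fin K))) : (#I : ℝ) ≤ pairCount K := by
  refine Nat.cast_le.2 ((card_le_univ I).trans ?_)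
  rw [Fintype.card_prod]
  exact Nat.le_mul_of_pos_left _ Fintype.card_pos

lemma sum_range_extendHistory {n : ℕ} (s : Fin n → Finset (Fin K))
    (f : ℕ → Finset (Fin K) → ℝ) :
    ∑ t ∈ range n, f t (extendHistory s t) = ∑ t : Fin n, f t (s t) := by
  rw [sum_range]
  exact sum_congr rfl fun t _ => by rw [extendHistory_of_lt s t.2]

namespace InnerBoundLP

lemma abs_netInput_le {n : ℕ} {k : Fin K} (I : Finset (Finset (Fin K) × Finset (Fin K)))
    (S : Finset (Fin K)) (t : ℕ) (A : Finset (Fin K)) :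
    |netInput prec x w n k I S t A| ≤ pairCount K := by
  classical
  refine le_trans ?_ (card_le_pairCount I)
  refine (abs_sum_le_sum_abs _ _).trans ?_
  rw [card_eq_sum_ones, Nat.cast_sum, Nat.cast_one]
  refine sum_le_sum fun a _ => ?_
  split_ifs
  · exact abs_gain_le S a A
  · simp

lemma mean_netInput_le (h : InnerBoundLP P prec R x w)
    (hord : IsStrictTotalOrder (Finset (Fin K)) prec) (hx : ∑ S, x S ≤ 1) {k : Fin K}
    {I : Finset (Finset (Fin K) × Finset (Fin K))} (hI : I ⊆ stages k) (S : Finset (Fin K))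
    (n : ℕ) :
    ∑ t : Fin n, ∑ A, P.p A * netInput prec x w n k I S t A ≤
      n * (∑ a ∈ I, w k a.1 a.2 * drift P S a) + pairCount K := by
  classical
  have h1 : ∀ t : ℕ, ∑ A, P.p A * netInput prec x w n k I S t A =
      ∑ a ∈ I, if InStage prec x w n k a t then drift P S a else 0 := by
    intro t
    unfold netInput drift
    simp_rw [mul_sum]
    rw [sum_comm]
    refine sum_congr rfl fun a _ => ?_
    split_ifs
    · rfl
    · simp
  have h2 : ∑ t : Fin n, ∑ A, P.p A * netInput prec x w n k I S t A =
      ∑ a ∈ I, (#{t ∈ range n | InStage prec x w n k a t} : ℝ) * drift P S a := by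
    simp_rw [h1]
    rw [Fin.sum_univ_eq_sum_range (fun t => ∑ a ∈ I, if InStage prec x w n k a t
      then drift P S a else 0), sum_comm]
    refine sum_congr rfl fun a _ => ?_
    rw [← sum_filter, sum_const, nsmul_eq_mul]
  have h3 : ∀ a ∈ I, (#{t ∈ range n | InStage prec x w n k a t} : ℝ) * drift P S a ≤
      n * (w k a.1 a.2 * drift P S a) + 1 := by
    intro a ha
    have hend := h.stageStart_add_le_sum (fun S => irrefl_of prec S) (hI ha)
    have hcount := abs_card_inBlock_sub_le (n := n) (h.stageStart_nonneg k a)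
      (h.w_nonneg' (hI ha)) (hend.trans hx)
    have hmul : |((#{t ∈ range n | InStage prec x w n k a t} : ℝ) - n * w k a.1 a.2) *
        drift P S a| ≤ 1 := by
      rw [abs_mul]
      exact mul_le_one₀ hcount (abs_nonneg _) (abs_drift_le P S a)
    have := (abs_le.1 hmul).2
    linarith
  rw [h2]
  refine (sum_le_sum h3).trans ?_
  rw [sum_add_distrib, ← mul_sum, sum_const, nsmul_eq_mul, mul_one]
  exact add_le_add_right (card_le_pairCount I) _

lemma prob_netInput_ge_le (h : InnerBoundLP P prec R x w)
    (hord : IsStrictTotalOrder (Finset (Fin K)) prec) (hx : ∑ S, x S ≤ 1) {k : Fin K}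
    {I : Finset (Finset (Fin K) × Finset (Fin K))} (hI : I ⊆ stages k) (S : Finset (Fin K))
    {v δ : ℝ} (hv : ∑ a ∈ I, w k a.1 a.2 * drift P S a ≤ v) (hδ : 0 < δ) (hδ1 : δ ≤ 1) (n : ℕ) :
    P.prob n (fun s => n * v + pairCount K + δ * n ≤
      ∑ t : Fin n, netInput prec x w n k I S t (s t)) ≤
      Real.exp (-(δ ^ 2 / (4 * pairCount K ^ 2)) * n) := by
  have hc := one_le_pairCount K
  refine P.prob_sum_ge_le (fun t : Fin n => netInput prec x w n k I S t) (by linarith)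
    (fun t A => abs_netInput_le I S t A) hδ (hδ1.trans hc) ?_
  refine (h.mean_netInput_le hord hx hI S n).trans (add_le_add_left ?_ _)
  exact mul_le_mul_of_nonneg_left hv (Nat.cast_nonneg n)

end InnerBoundLP

open Classical in
lemma prob_receptions_le {n : ℕ} {α η δ : ℝ} (hα : 0 ≤ α) (hη : 0 ≤ η) (h1 : α + η ≤ 1)
    (hδ : 0 < δ) (hδ1 : δ ≤ 1) (k : Fin K) :
    P.prob n (fun s => (∑ t : Fin n, if InBlock n α η t ∧ k ∈ s t then (1 : ℝ) else 0) ≤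
      n * η * P.pUnion {k} - 1 - δ * n) ≤
      Real.exp (-(δ ^ 2 / (4 * pairCount K ^ 2)) * n) := by
  have hc := one_le_pairCount K
  have hU0 : 0 ≤ P.pUnion {k} := sum_nonneg fun _ _ => P.p_nonneg _
  have hU1 : P.pUnion {k} ≤ 1 := by
    rw [← P.p_sum]
    exact sum_le_sum_of_subset_of_nonneg (filter_subset _ _) fun _ _ _ => P.p_nonneg _
  have hmean : ∑ t : Fin n, ∑ A, P.p A * -(if InBlock n α η t ∧ k ∈ A then (1 : ℝ) else 0) ≤
      -(n * η * P.pUnion {k}) + 1 := by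
    have h2 : ∀ t : ℕ, ∑ A, P.p A * -(if InBlock n α η t ∧ k ∈ A then (1 : ℝ) else 0) =
        if InBlock n α η t then -P.pUnion {k} else 0 := by
      intro t
      have h3 : ∀ A : Finset (Fin K), (A ∩ {k}).Nonempty ↔ k ∈ A := by
        intro A
        simp [Finset.Nonempty]
      unfold BroadcastPEC.pUnion
      simp_rw [h3]
      split_ifs with ht
      · rw [sum_filter, ← sum_neg_distrib]
        refine sum_congr rfl fun A _ => ?_
        by_cases hkA : k ∈ A <;> simp [ht, hkA]
      · simp [ht]
    simp_rw [h2]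
    rw [Fin.sum_univ_eq_sum_range (fun t => if InBlock n α η t then -P.pUnion {k} else 0),
      ← sum_filter, sum_const, nsmul_eq_mul]
    have h3 := (abs_le.1 (abs_card_inBlock_sub_le (n := n) hα hη h1)).1
    have h4 := mul_le_mul_of_nonneg_right h3 hU0
    linarith
  refine le_trans (P.prob_mono fun s hs => ?_) (P.prob_sum_ge_le
    (fun (t : Fin n) A => -(if InBlock n α η t ∧ k ∈ A then (1 : ℝ) else 0))
    (by linarith) (fun t A => ?_) hδ (hδ1.trans hc) hmean)
  · rw [sum_neg_distrib]
    linarith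
  · rw [abs_neg]
    split_ifs <;> simp <;> linarith

open Classical in
lemma exists_mem_of_receptions_pos {n : ℕ} {α η : ℝ} {k : Fin K} {s : Fin n → Finset (Fin K)}
    (h : 0 < ∑ t : Fin n, if InBlock n α η t ∧ k ∈ s t then (1 : ℝ) else 0) :
    ∃ t : Fin n, InBlock n α η t ∧ k ∈ s t := by
  by_contra! hcon
  refine h.ne' (sum_eq_zero fun t _ => if_neg fun ht => hcon t ht.1 ht.2)

namespace InnerBoundLP

open Classical in
/-- If all net inputs and receptions are close to their means, then receiver `k` can decode: few
packets are unfinished after the phases, and the clean-up block of the session is long enough for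
them. The bound `hn` compares the leftover of all queues with the receptions in one block. -/
lemma decodable_of_typical (h : InnerBoundLP P prec R x w)
    (hord : IsStrictTotalOrder (Finset (Fin K)) prec) {η δ : ℝ} (hη : 0 < η)
    (hxη : ∑ S, x S + (K + 2) * η ≤ 1) (hδ : 0 < δ) {n m : ℕ} {k : Fin K} (hm : m ≤ n * R k + 1)
    (hn : pairCount K * (pairCount K + 1 + δ * n) ≤ n * η * P.pUnion {k} - 1 - δ * n)
    {s : Fin n → Finset (Fin K)}
    (htot : ∀ S, k ∉ S → ∑ t : Fin n, netInput prec x w n k (stages k) S t (s t) <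
      n * (if S = ∅ then -R k else 0) + pairCount K + δ * n)
    (hafter : ∀ b ∈ stages k,
      ∑ t : Fin n, netInput prec x w n k (stagesAfter prec k b) b.1 t (s t) <
        n * 0 + pairCount K + δ * n)
    (hrec : ∀ α ∈ ({∑ S, x S + (k : ℕ) * η, 1 - 2 * η, 1 - η} : Finset ℝ),
      n * η * P.pUnion {k} - 1 - δ * n <
        ∑ t : Fin n, if InBlock n α η t ∧ k ∈ s t then (1 : ℝ) else 0) :
    Decodable (h.schedule hord hη.le n) m ⌈(n : ℝ) * (1 - 2 * η)⌉₊ ⌈(n : ℝ) * (1 - η)⌉₊ n k s := by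
  have hn0 : (0 : ℝ) ≤ n := Nat.cast_nonneg n
  have hc := one_le_pairCount K
  have hX0 : 0 ≤ ∑ S, x S := sum_nonneg fun S _ => h.x_nonneg S
  have hδn : 0 ≤ δ * n := by positivity
  have hpos : 0 ≤ n * η * P.pUnion {k} - 1 - δ * n := le_trans (by positivity) hn
  have hk1 : ((k : ℕ) : ℝ) + 1 ≤ K := by exact_mod_cast k.2
  have hkη := mul_le_mul_of_nonneg_right hk1 hη.le
  have hK0 : (0 : ℝ) ≤ K * η := by positivity
  have hx1 : ∑ S, x S ≤ 1 := by linarith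
  refine ⟨?_, ?_, ?_⟩
  · set D := h.schedule hord hη.le n with hD
    set t₀ := ⌈(n : ℝ) * ∑ S, x S⌉₊ with ht₀
    set n₁ := ⌈(n : ℝ) * (1 - 2 * η)⌉₊ with hn₁
    have ht₀n₁ : t₀ ≤ n₁ := Nat.ceil_mono (mul_le_mul_of_nonneg_left (by linarith) hn0)
    have hqueue : ∀ S, k ∉ S →
        (D.queue m (extendHistory s) k S t₀ : ℝ) ≤ pairCount K + 1 + δ * n := by
      intro S hS
      refine h.queue_le hord hη.le hx1 (extendHistory s) S ?_ fun T hT => ?_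
      · rw [sum_range_extendHistory]
        have h1 := htot S hS
        split_ifs at h1 ⊢ <;> linarith
      · rw [sum_range_extendHistory s
          (netInput prec x w n k (stagesAfter prec k (S, T)) S)]
        have h1 := hafter _ hT
        linarith
    have hunf : (D.unfinished m (extendHistory s) k t₀ : ℝ) ≤
        pairCount K * (pairCount K + 1 + δ * n) := by
      have h1 : (D.unfinished m (extendHistory s) k t₀ : ℝ) ≤
          ∑ S with k ∉ S, (D.queue m (extendHistory s) k S t₀ : ℝ) := by
        exact_mod_cast D.unfinished_le_sum_queue m (extendHistory s) t₀
      refine h1.trans ((sum_le_card_nsmul _ _ _ fun S hS => hqueue S (by simpa using hS)).trans ?_)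
      rw [nsmul_eq_mul]
      exact mul_le_mul_of_nonneg_right (card_sets_le_pairCount _) (by linarith)
    have hclean := hn.trans_lt (hrec (∑ S, x S + (k : ℕ) * η) (by simp))
    rw [sum_boole] at hclean
    have hcard : #{t : Fin n | InBlock n (∑ S, x S + (k : ℕ) * η) η t ∧ k ∈ s t} ≤
        #{t ∈ Ico t₀ n₁ | (∀ S, k ∉ S → D.elig t k S) ∧ k ∈ extendHistory s t} := by
      refine card_le_card_of_injOn (fun t => (t : ℕ)) ?_ (Fin.val_injective.injOn)
      intro t ht
      obtain ⟨ht1, ht2⟩ := (mem_filter.1 (mem_coe.1 ht)).2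
      refine mem_coe.2 (mem_filter.2 ⟨mem_Ico.2 ⟨?_, ?_⟩, ?_, ?_⟩)
      · exact not_lt.1 fun hlt => not_inCleanUp_of_lt hη.le hlt ht1
      · rw [hn₁, Nat.lt_ceil]
        exact ht1.2.trans_le (mul_le_mul_of_nonneg_left (by linarith) hn0)
      · exact fun S hS => Or.inr ⟨hS, ht1⟩
      · rwa [extendHistory_of_lt s t.2]
    have hlt : D.unfinished m (extendHistory s) k t₀ <
        #{t : Fin n | InBlock n (∑ S, x S + (k : ℕ) * η) η t ∧ k ∈ s t} := by
      exact_mod_cast hunf.trans_lt hclean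
    have hzero : D.unfinished m (extendHistory s) k n₁ = 0 := by
      have := D.unfinished_le_sub (k := k) m (extendHistory s) ht₀n₁
      omega
    intro j
    rw [Schedule.unfinished, card_eq_zero, filter_eq_empty_iff] at hzero
    exact not_not.1 (hzero (mem_univ j))
  · obtain ⟨t, ht, hk⟩ := exists_mem_of_receptions_pos (hpos.trans_lt (hrec (1 - 2 * η) (by simp)))
    refine ⟨t, Nat.ceil_le.2 ht.1, Nat.lt_ceil.2 ?_, hk⟩
    have := ht.2
    rwa [show 1 - 2 * η + η = 1 - η by ring] at this
  · obtain ⟨t, ht, hk⟩ := exists_mem_of_receptions_pos (hpos.trans_lt (hrec (1 - η) (by simp)))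
    have h2 : ⌈(n : ℝ) * (1 - η)⌉₊ ≤ t := Nat.ceil_le.2 ht.1
    exact ⟨t, (Nat.ceil_mono (mul_le_mul_of_nonneg_left (by linarith) hn0)).trans h2, h2, hk⟩

lemma prob_not_decodable_le (h : InnerBoundLP P prec R x w)
    (hord : IsStrictTotalOrder (Finset (Fin K)) prec) (hcard : CardinalityCompatible prec)
    {η δ : ℝ} (hη : 0 < η) (hxη : ∑ S, x S + (K + 2) * η ≤ 1) (hδ : 0 < δ) (hδ1 : δ ≤ 1)
    {n m : ℕ} {k : Fin K} (hm : m ≤ n * R k + 1)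
    (hn : pairCount K * (pairCount K + 1 + δ * n) ≤ n * η * P.pUnion {k} - 1 - δ * n) :
    P.prob n (fun s => ¬ Decodable (h.schedule hord hη.le n) m ⌈(n : ℝ) * (1 - 2 * η)⌉₊
      ⌈(n : ℝ) * (1 - η)⌉₊ n k s) ≤
      (2 * pairCount K + 3) * Real.exp (-(δ ^ 2 / (4 * pairCount K ^ 2)) * n) := by
  classical
  set e := Real.exp (-(δ ^ 2 / (4 * pairCount K ^ 2)) * n) with he
  have he0 : 0 ≤ e := (Real.exp_pos _).le
  have hX0 : 0 ≤ ∑ S, x S := sum_nonneg fun S _ => h.x_nonneg S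
  have hk1 : ((k : ℕ) : ℝ) + 1 ≤ K := by exact_mod_cast k.2
  have hkη := mul_le_mul_of_nonneg_right hk1 hη.le
  have hK0 : (0 : ℝ) ≤ K * η := by positivity
  have hx1 : ∑ S, x S ≤ 1 := by linarith
  let I₁ : Finset (Finset (Fin K)) := {S | k ∉ S}
  let I₃ : Finset ℝ := {∑ S, x S + (k : ℕ) * η, 1 - 2 * η, 1 - η}
  let E₁ : Finset (Fin K) → (Fin n → Finset (Fin K)) → Prop := fun S s =>
    n * (if S = ∅ then -R k else 0) + pairCount K + δ * n ≤
      ∑ t : Fin n, netInput prec x w n k (stages k) S t (s t)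
  let E₂ : Finset (Fin K) × Finset (Fin K) → (Fin n → Finset (Fin K)) → Prop := fun b s =>
    n * 0 + pairCount K + δ * n ≤
      ∑ t : Fin n, netInput prec x w n k (stagesAfter prec k b) b.1 t (s t)
  let E₃ : ℝ → (Fin n → Finset (Fin K)) → Prop := fun α s =>
    (∑ t : Fin n, if InBlock n α η t ∧ k ∈ s t then (1 : ℝ) else 0) ≤
      n * η * P.pUnion {k} - 1 - δ * n
  have hbad : ∀ s, ¬ Decodable (h.schedule hord hη.le n) m ⌈(n : ℝ) * (1 - 2 * η)⌉₊
      ⌈(n : ℝ) * (1 - η)⌉₊ n k s →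
      (∃ S ∈ I₁, E₁ S s) ∨ (∃ b ∈ stages k, E₂ b s) ∨ ∃ α ∈ I₃, E₃ α s := by
    intro s hs
    by_contra hcon
    simp only [not_or, not_exists, not_and] at hcon
    obtain ⟨h1, h2, h3⟩ := hcon
    exact hs (h.decodable_of_typical hord hη hxη hδ hm hn
      (fun S hS => not_le.1 (h1 S (by simpa [I₁] using hS))) (fun b hb => not_le.1 (h2 b hb))
      fun α hα => not_le.1 (h3 α hα))
  have hp₁ : P.prob n (fun s => ∃ S ∈ I₁, E₁ S s) ≤ pairCount K * e := by
    refine (P.prob_exists_le I₁ E₁).trans ((sum_le_card_nsmul _ _ e fun S hS => ?_).trans ?_)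
    · exact h.prob_netInput_ge_le hord hx1 subset_rfl S
        (h.sum_drift_le (by simpa [I₁] using hS)) hδ hδ1 n
    · rw [nsmul_eq_mul]
      exact mul_le_mul_of_nonneg_right (card_sets_le_pairCount _) he0
  have hp₂ : P.prob n (fun s => ∃ b ∈ stages k, E₂ b s) ≤ pairCount K * e := by
    refine (P.prob_exists_le (stages k) E₂).trans
      ((sum_le_card_nsmul _ _ e fun b hb => ?_).trans ?_)
    · exact h.prob_netInput_ge_le hord hx1 (filter_subset _ _) b.1
        (h.sum_drift_after_le hord hcard hb) hδ hδ1 n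
    · rw [nsmul_eq_mul]
      exact mul_le_mul_of_nonneg_right (card_le_pairCount _) he0
  have hp₃ : P.prob n (fun s => ∃ α ∈ I₃, E₃ α s) ≤ 3 * e := by
    refine (P.prob_exists_le I₃ E₃).trans ((sum_le_card_nsmul _ _ e fun α hα => ?_).trans ?_)
    · have hα' : 0 ≤ α ∧ α + η ≤ 1 := by
        simp only [I₃, mem_insert, mem_singleton] at hα
        rcases hα with rfl | rfl | rfl
        · exact ⟨by positivity, by linarith⟩
        · constructor <;> linarith
        · constructor <;> linarith
      exact prob_receptions_le hα'.1 hη.le hα'.2 hδ hδ1 k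
    · rw [nsmul_eq_mul]
      refine mul_le_mul_of_nonneg_right ?_ he0
      exact_mod_cast card_le_three
  calc _ ≤ _ := P.prob_mono hbad
    _ ≤ _ := P.prob_or_le _ _
    _ ≤ pairCount K * e + (pairCount K * e + 3 * e) :=
        add_le_add hp₁ ((P.prob_or_le _ _).trans (add_le_add hp₂ hp₃))
    _ = _ := by ring

/-- The failure probability tends to zero for every session with a positive rate. -/
lemma exists_prob_not_decodable_lt (h : InnerBoundLP P prec R x w)
    (hord : IsStrictTotalOrder (Finset (Fin K)) prec) (hcard : CardinalityCompatible prec)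
    {η : ℝ} (hη : 0 < η) (hxη : ∑ S, x S + (K + 2) * η ≤ 1) {k : Fin K} (hk : 0 < R k) {ε : ℝ}
    (hε : 0 < ε) : ∃ N : ℕ, ∀ n, N ≤ n →
      P.prob n (fun s => ¬ Decodable (h.schedule hord hη.le n) ⌈(n : ℝ) * R k⌉₊
        ⌈(n : ℝ) * (1 - 2 * η)⌉₊ ⌈(n : ℝ) * (1 - η)⌉₊ n k s) < ε := by
  classical
  have hc := one_le_pairCount K
  set c := pairCount K with hcdef
  have hU0 : 0 ≤ P.pUnion {k} := sum_nonneg fun _ _ => P.p_nonneg _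
  have hU : 0 < P.pUnion {k} := by
    refine hU0.lt_of_ne fun h0 => ?_
    have := h.rate_le k
    rw [← h0, zero_mul] at this
    linarith
  set u := η * P.pUnion {k} with hu
  have hu0 : 0 < u := mul_pos hη hU
  set δ : ℝ := min 1 (u / (2 * (c + 1))) with hδdef
  have hδ : 0 < δ := by
    refine lt_min one_pos ?_
    positivity
  have hδu : δ * (c + 1) ≤ u / 2 := by
    have h1 : δ ≤ u / (2 * (c + 1)) := min_le_right _ _
    rw [le_div_iff₀ (by positivity)] at h1
    linarith
  set γ := δ ^ 2 / (4 * c ^ 2) with hγ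
  have hγ0 : 0 < γ := by positivity
  have hlim : Filter.Tendsto (fun n : ℕ => (2 * c + 3) * Real.exp (-γ * n)) Filter.atTop
      (nhds ((2 * c + 3) * 0)) := by
    refine Filter.Tendsto.const_mul _ (Real.tendsto_exp_atBot.comp ?_)
    exact tendsto_natCast_atTop_atTop.const_mul_atTop_of_neg (by linarith)
  rw [mul_zero] at hlim
  obtain ⟨N₁, hN₁⟩ := Filter.eventually_atTop.1 (hlim.eventually_lt_const hε)
  obtain ⟨N₂, hN₂⟩ := exists_nat_ge ((c * (c + 1) + 1) / (u / 2))
  refine ⟨max N₁ N₂, fun n hn => ?_⟩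
  have hnN₂ : (N₂ : ℝ) ≤ n := Nat.cast_le.2 ((le_max_right _ _).trans hn)
  have hn' := hN₂.trans hnN₂
  rw [div_le_iff₀ (by positivity)] at hn'
  have hn0 : (0 : ℝ) ≤ n := Nat.cast_nonneg n
  refine (h.prob_not_decodable_le hord hcard hη hxη hδ (min_le_left _ _) ?_ ?_).trans_lt
    (hN₁ n ((le_max_left _ _).trans hn))
  · exact (Nat.ceil_lt_add_one (mul_nonneg hn0 hk.le)).le
  · have h2 := mul_le_mul_of_nonneg_left hδu hn0
    have h3 : (n : ℝ) * η * P.pUnion {k} = n * u := by rw [hu]; ring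
    rw [h3]
    linarith

end InnerBoundLP
end Failure

end

theorem mainTheorem3 {K : ℕ} (prec : Finset (Fin K) → Finset (Fin K) → Prop)
    (hord : IsStrictTotalOrder (Finset (Fin K)) prec) (hcard : CardinalityCompatible prec)
    (P : BroadcastPEC K) (R : Fin K → ℝ) (hR : ∀ k, 0 ≤ R k)
    (hLP : ∃ (x : Finset (Fin K) → ℝ) (w : Fin K → Finset (Fin K) → Finset (Fin K) → ℝ),
      InnerBoundLP P prec R x w) :
    LinearlyAchievable P R := by
  classical
  obtain ⟨x, w, h⟩ := hLP
  intro ε hε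
  set η : ℝ := (1 - ∑ S, x S) / (K + 2) with hηdef
  have hK : (0 : ℝ) < K + 2 := by positivity
  have hη : 0 < η := div_pos (by linarith [h.total]) hK
  have hxη : ∑ S, x S + (K + 2) * η ≤ 1 := by
    rw [hηdef, mul_div_cancel₀ _ hK.ne']
    linarith
  have hN : ∀ k, ∃ N : ℕ, 0 < R k → ∀ n, N ≤ n →
      P.prob n (fun s => ¬ Decodable (h.schedule hord hη.le n) ⌈(n : ℝ) * R k⌉₊
        ⌈(n : ℝ) * (1 - 2 * η)⌉₊ ⌈(n : ℝ) * (1 - η)⌉₊ n k s) < ε / 2 := by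
    intro k
    by_cases hk : 0 < R k
    · obtain ⟨N, hN⟩ := h.exists_prob_not_decodable_lt hord hcard hη hxη hk (half_pos hε)
      exact ⟨N, fun _ => hN⟩
    · exact ⟨0, fun hk' => absurd hk' hk⟩
  choose N hN using hN
  refine ⟨univ.sup N, fun n hn => ?_⟩
  set n₁ := ⌈(n : ℝ) * (1 - 2 * η)⌉₊ with hn₁
  obtain ⟨q₁, hq₁⟩ := exists_nat_gt (2 / ε)
  refine ⟨max (max K (Fintype.card (Fin n₁ → Finset (Fin K)))) q₁, fun F _ _ hF => ?_⟩
  have hn₁n : n₁ ≤ n := by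
    rw [hn₁, Nat.ceil_le]
    exact mul_le_of_le_one_right (Nat.cast_nonneg n) (by linarith)
  obtain ⟨c, hlin, hc⟩ := exists_linear_code (F := F) (h.schedule hord hη.le n)
    (fun k => ⌈(n : ℝ) * R k⌉₊) (n₂ := ⌈(n : ℝ) * (1 - η)⌉₊) hn₁n
    ((le_max_left _ _).trans ((le_max_left _ _).trans hF))
    ((le_max_right _ _).trans ((le_max_left _ _).trans hF))
  refine ⟨c, hlin, fun k => ?_⟩
  rcases Nat.eq_zero_or_pos ⌈(n : ℝ) * R k⌉₊ with h0 | hpos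
  · rwa [c.errorProb_eq_zero P h0]
  have hk : 0 < R k := by
    refine (hR k).lt_of_ne fun h0 => ?_
    simp [← h0] at hpos
  have hprob := hN k hk n ((le_sup (mem_univ k)).trans hn)
  have hFq : 1 / (Fintype.card F : ℝ) < ε / 2 := by
    have h1 : (q₁ : ℝ) ≤ Fintype.card F := Nat.cast_le.2 ((le_max_right _ _).trans hF)
    have h2 : 2 / ε < Fintype.card F := hq₁.trans_le h1
    rw [one_div_lt (lt_trans (by positivity) h2) (half_pos hε), one_div_div]
    exact h2
  refine (hc P k hpos).trans_lt ?_
  simp_rw [mul_add, sum_add_distrib, ← sum_mul, P.sum_prod_p, one_mul]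
  have h3 : ∑ s : Fin n → Finset (Fin K), (∏ t, P.p (s t)) *
      (if Decodable (h.schedule hord hη.le n) ⌈(n : ℝ) * R k⌉₊ n₁ ⌈(n : ℝ) * (1 - η)⌉₊ n k s
        then (0 : ℝ) else 1) < ε / 2 := by
    refine lt_of_eq_of_lt (sum_congr rfl fun s _ => ?_) hprob
    by_cases hs : Decodable (h.schedule hord hη.le n) ⌈(n : ℝ) * R k⌉₊ n₁ ⌈(n : ℝ) * (1 - η)⌉₊ n k s
    · rw [if_pos hs, if_neg (not_not.2 hs)]
    · rw [if_neg hs, if_pos hs]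
  linarith
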